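/- Let $\Delta=\sum_{m\ge 0}q^{(2m+1)^2}\in\mathbf F_2[[q]]$ (the reduction modulo $2$ of the discriminant form $q\prod_{n\ge1}(1-q^n)^{24}$), and let $\mathcal F\subset\mathbf F_2[[q]]$ be the $\mathbf F_2$-vector space spanned by $\Delta,\Delta^3,\Delta^5,\dots$ For an odd prime $p$ and $f=\sum_{n\ge0}c(n)q^n\in\mathbf F_2[[q]]$ put $T_pf=\sum_{n\ge 0}\gamma(n)q^n$, where $\gamma(n)=c(pn)$ if $p\nmid n$ and $\gamma(n)=c(pn)+c(n/p)$ if $p\mid n$. For an integer $k=\sum_{i\ge0}\beta_i2^i\ge 0$ with $\beta_i\in\{0,1\}$, put $n_3(k)=\sum_{i\ge0}\beta_{2i+1}2^i$, $n_5(k)=\sum_{i\ge0}\beta_{2i+2}2^i$ and $h(k)=n_3(k)+n_5(k)$; the pair $[n_3(k),n_5(k)]$ is the code of $k$. For $k,\ell$ of the same parity write $k\prec\ell$ if $h(k)<h(\ell)$, or $h(k)=h(\ell)$ and $n_5(k)<n_5(\ell)$; this is a strict total order on the odd integers $\ge 0$. A nonzero $f\in\mathcal F$ can be written uniquely as $f=\Delta^{m_1}+\cdots+\Delta^{m_r}$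 with $m_1\succ m_2\succ\cdots\succ m_r$ odd; $m_1$ is called the dominant exponent of $f$, and $h(f)=h(m_1)=\max_i h(m_i)$. Put $h(0)=-\infty$. The order of nilpotence $g(f)$ of $f\ne0$ is the smallest integer $g\ge 0$ such that $T_{p_1}T_{p_2}\cdots T_{p_g}f=0$ for every sequence of $g$ (not necessarily distinct) odd primes $p_1,\dots,p_g$. Theorem. Let $f\in\mathcal F$, $f\neq0$, with dominant exponent $m_1$. Then: (i) For $p=3$ and $p=5$, $T_pf\in\mathcal F$ and $h(T_pf)\le h(f)-1$. (ii) If $n_3(m_1)\ge1$, then $T_3f\ne0$ and the dominant exponent of $T_3f$ has code $[n_3(m_1)-1,\,n_5(m_1)]$. (iii) If $n_5(m_1)\ge1$, then $T_5f\ne0$ and the dominant exponent of $T_5f$ has code $[n_3(m_1),\,n_5(m_1)-1]$. (iv) $T_3^{n_3(m_1)}T_5^{n_5(m_1)}f=\Delta$. (v) The order of nilpotence of $f$ exists (is finite) and $g(f)=h(f)+1$. -/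

import Mathlib

open scoped PowerSeries

namespace HeckeModTwo

/-- The series `Δ = ∑_{m ≥ 0} q ^ ((2 m + 1) ^ 2)` in `𝔽₂⟦q⟧`. -/
noncomputable def Delta : (ZMod 2)⟦X⟧ :=
  open Classical in PowerSeries.mk fun n => if ∃ m : ℕ, n = (2 * m + 1) ^ 2 then 1 else 0

/-- The space `𝓕` spanned over `𝔽₂` by the powers of `Δ` with odd exponent. -/
noncomputable def oddForms : Submodule (ZMod 2) (ZMod 2)⟦X⟧ :=
  Submodule.span (ZMod 2) {f | ∃ k : ℕ, Odd k ∧ f = Delta ^ k}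

/-- The Hecke operator `T_p` on `q`-expansions modulo `2` (for `p` an odd prime): the `n`-th
coefficient of `T_p f` is `c (p n)` if `p ∤ n`, and `c (p n) + c (n / p)` if `p ∣ n`. -/
noncomputable def hecke (p : ℕ) : Module.End (ZMod 2) (ZMod 2)⟦X⟧ where
  toFun f := PowerSeries.mk fun n =>
    if p ∣ n then PowerSeries.coeff (p * n) f + PowerSeries.coeff (n / p) f
    else PowerSeries.coeff (p * n) f
  map_add' f g := by
    ext n
    simp only [PowerSeries.coeff_mk, map_add]
    split_ifs <;> ring
  map_smul' a f := by
    ext n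
    simp only [PowerSeries.coeff_mk, map_smul, RingHom.id_apply, smul_eq_mul]
    split_ifs <;> ring

/-- `n₃(k) = ∑ i, β (2 i + 1) * 2 ^ i`, where `k = ∑ i, β i * 2 ^ i` in base `2`
(the digits of index `> k` vanish, so the range of summation is harmless). -/
def n₃ (k : ℕ) : ℕ := ∑ i ∈ Finset.range k, (k.testBit (2 * i + 1)).toNat * 2 ^ i

/-- `n₅(k) = ∑ i, β (2 i + 2) * 2 ^ i`, where `k = ∑ i, β i * 2 ^ i` in base `2`. -/
def n₅ (k : ℕ) : ℕ := ∑ i ∈ Finset.range k, (k.testBit (2 * i + 2)).toNat * 2 ^ i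

/-- `h(k) = n₃(k) + n₅(k)`. -/
def h (k : ℕ) : ℕ := n₃ k + n₅ k

/-- The code `[n₃(k), n₅(k)]` of `k`. -/
def code (k : ℕ) : ℕ × ℕ := (n₃ k, n₅ k)

/-- The strict domination relation `k ≺ l` (used between integers of the same parity). -/
def Dominated (k l : ℕ) : Prop := h k < h l ∨ (h k = h l ∧ n₅ k < n₅ l)

open Classical in
/-- The set of exponents `k` such that `Δ ^ k` occurs in the polynomial in `Δ` equal to `f`,
i.e. the unique finite set `s` with `f = ∑ k ∈ s, Δ ^ k` (see `exponents_sum`);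
the empty set if `f` is not a polynomial in `Δ`. -/
noncomputable def exponents (f : (ZMod 2)⟦X⟧) : Finset ℕ :=
  if hf : ∃ s : Finset ℕ, f = ∑ k ∈ s, Delta ^ k then hf.choose else ∅

/-- `m` is the dominant exponent of `f`. -/
def IsDominantExponent (f : (ZMod 2)⟦X⟧) (m : ℕ) : Prop :=
  m ∈ exponents f ∧ ∀ k ∈ exponents f, k ≠ m → Dominated k m

/-- `h(f)`: the maximum of `h` over the exponents of `f`, with `h(0) = -∞ = ⊥`. -/
noncomputable def hForm (f : (ZMod 2)⟦X⟧) : WithBot ℕ :=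
  (exponents f).sup fun k => (h k : WithBot ℕ)

/-- The integers `g` such that `T_{p₁} T_{p₂} ⋯ T_{p_g} f = 0` for every sequence of `g` odd
primes `p₁, …, p_g` (repetitions are allowed). -/
def nilpotencySet (f : (ZMod 2)⟦X⟧) : Set ℕ :=
  {g | ∀ p : List ℕ, p.length = g → (∀ q ∈ p, q.Prime ∧ Odd q) →
    (p.map hecke).prod f = 0}

open Classical in
/-- The order of nilpotence `g(f)`: the least element of `nilpotencySet f`,
with the convention `g(0) = -∞ = ⊥`. -/
noncomputable def nilpotencyOrder (f : (ZMod 2)⟦X⟧) : WithBot ℕ :=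
  if f = 0 then ⊥ else ((sInf (nilpotencySet f) : ℕ) : WithBot ℕ)

theorem coeff_Delta_pow_self (n : ℕ) : PowerSeries.coeff n (Delta ^ n) = 1 ∧
    ∀ k, n < k → PowerSeries.coeff n (Delta ^ k) = 0 := by
  have h0 : PowerSeries.coeff 0 Delta = 0 := by
    have : ¬ ∃ m : ℕ, 0 = (2 * m + 1) ^ 2 := by
      rintro ⟨m, hm⟩
      have : 0 < (2 * m + 1) ^ 2 := by positivity
      omega
    simp only [Delta, PowerSeries.coeff_mk, if_neg this]
  have hX : (PowerSeries.X : (ZMod 2)⟦X⟧) ∣ Delta :=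
    PowerSeries.X_dvd_iff.2 (by simpa using h0)
  obtain ⟨U, hU⟩ := hX
  have h1 : PowerSeries.coeff 1 Delta = 1 := by
    have : ∃ m : ℕ, 1 = (2 * m + 1) ^ 2 := ⟨0, rfl⟩
    simp only [Delta, PowerSeries.coeff_mk, if_pos this]
  have hU1 : PowerSeries.constantCoeff U = 1 := by
    rw [hU, ← zero_add 1, PowerSeries.coeff_succ_X_mul] at h1
    simpa using h1
  constructor
  · rw [hU, mul_pow, PowerSeries.coeff_X_pow_mul']
    simp [hU1]
  · intro k hk
    rw [hU, mul_pow, PowerSeries.coeff_X_pow_mul', if_neg (by omega)]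

/-- The exponents of `f` are well defined. -/
theorem sum_Delta_pow_injective {s t : Finset ℕ}
    (hst : ∑ k ∈ s, Delta ^ k = ∑ k ∈ t, Delta ^ k) : s = t := by
  have key : ∀ (u : Finset ℕ) (n : ℕ), PowerSeries.coeff n (∑ k ∈ u, Delta ^ k) =
      ∑ k ∈ u.filter (· < n), PowerSeries.coeff n (Delta ^ k) + if n ∈ u then 1 else 0 := by
    intro u n
    rw [map_sum, ← Finset.sum_filter_add_sum_filter_not u (· < n)]
    congr 1
    have : ∀ k ∈ u.filter (fun k => ¬ k < n), PowerSeries.coeff n (Delta ^ k) =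
        if k = n then 1 else 0 := by
      intro k hk
      rcases eq_or_ne k n with rfl | hne
      · simpa using (coeff_Delta_pow_self k).1
      · rw [if_neg hne]
        exact (coeff_Delta_pow_self n).2 k (by simp at hk; omega)
    rw [Finset.sum_congr rfl this, Finset.sum_ite_eq']
    simp
  ext n
  induction n using Nat.strong_induction_on with
  | _ n ih =>
    have hf : s.filter (· < n) = t.filter (· < n) := by
      ext k
      simp only [Finset.mem_filter]
      constructor
      · rintro ⟨a, b⟩
        exact ⟨(ih k b).1 a, b⟩
      · rintro ⟨a, b⟩
        exact ⟨(ih k b).2 a, b⟩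
    have := congrArg (PowerSeries.coeff n) hst
    rw [key, key, hf] at this
    have h2 := add_left_cancel this
    clear ih hf this hst key
    by_cases a : n ∈ s <;> by_cases b : n ∈ t <;> simp [a, b] at h2 ⊢

theorem exponents_sum (s : Finset ℕ) : exponents (∑ k ∈ s, Delta ^ k) = s := by
  have hf : ∃ t : Finset ℕ, ∑ k ∈ s, Delta ^ k = ∑ k ∈ t, Delta ^ k := ⟨s, rfl⟩
  rw [exponents, dif_pos hf]
  exact (sum_Delta_pow_injective hf.choose_spec).symm

/-- The dominant exponent is unique. -/
theorem IsDominantExponent.unique {f : (ZMod 2)⟦X⟧} {m m' : ℕ}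
    (hm : IsDominantExponent f m) (hm' : IsDominantExponent f m') : m = m' := by
  by_contra hne
  have h1 := hm.2 m' hm'.1 (Ne.symm hne)
  have h2 := hm'.2 m hm.1 hne
  unfold Dominated at h1 h2
  omega

end HeckeModTwo

/-!
The proof rests on two facts about the operators `T_p` modulo `2`.

**The space of odd forms is stable.** `Delta` is the reduction of the discriminant form, and `T_p`
is the reduction of the classical Hecke operator of weight `12 * k`, which preserves modular forms
of level one with integral `q`-expansion. Such a form, of weight divisible by `12`, is an integral
polynomial in the discriminant and `E₄ ^ 3`, and `E₄` is congruent to `1`; so `T_p` maps `Delta ^ k`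
to a polynomial in `Delta` (`hecke_Delta_pow_mem_adjoin`). As `T_p` respects the parity of the
exponents of `q`, the powers of `Delta` that occur are odd when `k` is odd (`hecke_mem_oddForms`).

**`T₃` and `T₅` lower codes.** The series `X = Delta q` and `Y = Delta (q ^ p)` satisfy
`(X + Y) ^ 4 = X * Y` for `p = 3` and `(X + Y) ^ 6 = X * Y` for `p = 5`
(`modular_equation_three`, `modular_equation_five`). As `Delta` is a theta series modulo `2`, these
are statements on the parity of the number of representations by `x ^ 2 + 3 * y ^ 2` and
`x ^ 2 + 5 * y ^ 2`, proved by explicit involutions. Since `T_p = U_p + V_p` and the equations are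
symmetric, they yield linear recurrences for `T_p (Delta ^ k)`, and raising them to powers of `2`
yields
`T_p (Delta ^ (j + 2 ^ t)) =
Delta ^ 2 ^ t * T_p (Delta ^ j) + Delta ^ 2 ^ (t - 2) * T_p (Delta ^ (j + 2 ^ (t - 2)))`,
exactly for `p = 3` and up to small terms for `p = 5`. The code of `2 ^ t` is twice the code of
`2 ^ (t - 2)`, and in the order by `(h, n₅)` a carry makes an exponent strictly smaller
(`ord_add_two_pow`). Induction on the leading binary digit of `k` therefore determines the dominant
term of `T_p (Delta ^ k)` (`LowersCode.step`, `hecke_three_lowersCode`, `hecke_five_lowersCode`).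

Passing from powers of `Delta` to arbitrary forms is linear algebra, and iterating gives
`T₃ ^ n₃ * T₅ ^ n₅` applied to `f` as `Delta`, hence a lower bound for the order of nilpotence. For
the upper bound every `T_p` has to lower `h` (`hecke_mem_heightLT`). If `T_p f` had a dominant
exponent of height at least `h f`, then the product of powers of `T₃` and `T₅` that sends `T_p f` to
`Delta` would send `f` to `0` or to `Delta`; as the Hecke operators commute and `T_p` annihilates
`Delta`, that is impossible.
-/

namespace HeckeModTwo

/-! ### Hecke operators on power series modulo `2` -/

section

open PowerSeries Finset.HasAntidiagonal

instance charP_powerSeries : CharP (ZMod 2)⟦X⟧ 2 :=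
  charP_of_injective_algebraMap (R := ZMod 2) (PowerSeries.C_injective (R := ZMod 2)) 2

theorem two_eq_zero_powerSeries : (2 : (ZMod 2)⟦X⟧) = 0 :=
  CharTwo.two_eq_zero

/-- Over the prime field `ZMod 2`, squaring is the substitution `q ↦ q ^ 2`. -/
theorem sq_eq_expand (f : (ZMod 2)⟦X⟧) : f ^ 2 = expand 2 two_ne_zero f := by
  have h := MvPowerSeries.map_frobenius_expand (p := 2) (hp := two_ne_zero) (f := f)
  rw [ZMod.frobenius_zmod] at h
  rw [← h]
  exact DFunLike.congr_fun (MvPowerSeries.map_id (σ := Unit) (R := ZMod 2)) _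

theorem coeff_hecke (p n : ℕ) (f : (ZMod 2)⟦X⟧) : coeff n (hecke p f) =
    coeff (p * n) f + if p ∣ n then coeff (n / p) f else 0 := by
  change coeff n (PowerSeries.mk fun n => if p ∣ n then coeff (p * n) f + coeff (n / p) f
    else coeff (p * n) f) = _
  rw [coeff_mk]
  split_ifs <;> simp

/-- The operator `U_p`, sending `∑ c(n) q ^ n` to `∑ c(p n) q ^ n`. -/
noncomputable def heckeU (p : ℕ) : (ZMod 2)⟦X⟧ →ₗ[ZMod 2] (ZMod 2)⟦X⟧ where
  toFun f := PowerSeries.mk fun n => coeff (p * n) f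
  map_add' f g := by ext; simp
  map_smul' a f := by ext; simp

theorem coeff_heckeU (p n : ℕ) (f : (ZMod 2)⟦X⟧) : coeff n (heckeU p f) = coeff (p * n) f :=
  coeff_mk n fun n => coeff (p * n) f

/-- The decomposition `T_p = U_p + V_p`. -/
theorem hecke_eq {p : ℕ} (hp : p ≠ 0) (f : (ZMod 2)⟦X⟧) :
    hecke p f = heckeU p f + expand p hp f := by
  ext n
  rw [coeff_hecke, map_add, coeff_heckeU, coeff_expand]

/-- `U_p` is linear over the series in `q ^ p`. -/
theorem heckeU_expand_mul {p : ℕ} (hp : p ≠ 0) (g f : (ZMod 2)⟦X⟧) :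
    heckeU p (expand p hp g * f) = g * heckeU p f := by
  ext n
  rw [coeff_heckeU, coeff_mul, coeff_mul]
  have hinj : Function.Injective (fun x : ℕ × ℕ => (p * x.1, p * x.2)) := by
    rintro ⟨a, b⟩ ⟨c, d⟩ h
    simpa [hp] using h
  rw [← Finset.sum_subset (s₁ := (antidiagonal n).image fun x => (p * x.1, p * x.2)),
    Finset.sum_image hinj.injOn]
  · refine Finset.sum_congr rfl fun x _ => ?_
    rw [coeff_heckeU, coeff_expand, if_pos (dvd_mul_right _ _),
      Nat.mul_div_cancel_left _ (Nat.pos_of_ne_zero hp)]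
  · intro x hx
    obtain ⟨y, hy, rfl⟩ := Finset.mem_image.1 hx
    rw [mem_antidiagonal] at hy ⊢
    rw [← mul_add, hy]
  · rintro ⟨a, b⟩ hx hx'
    rw [mem_antidiagonal] at hx
    rw [coeff_expand, if_neg, zero_mul]
    rintro ⟨c, rfl⟩
    obtain ⟨d, rfl⟩ : p ∣ b := (Nat.dvd_add_right (dvd_mul_right p c)).1 ⟨n, hx⟩
    refine hx' (Finset.mem_image.2 ⟨(c, d), ?_, rfl⟩)
    rw [mem_antidiagonal]
    exact Nat.eq_of_mul_eq_mul_left (Nat.pos_of_ne_zero hp) (by simpa [mul_add] using hx)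

theorem hecke_one {p : ℕ} (hp : p ≠ 0) : hecke p (1 : (ZMod 2)⟦X⟧) = 0 := by
  have h : heckeU p (1 : (ZMod 2)⟦X⟧) = 1 := by
    ext n
    rw [coeff_heckeU, coeff_one, coeff_one]
    simp [hp]
  rw [hecke_eq hp, h, map_one]
  exact CharTwo.add_self_eq_zero _

theorem hecke_comm {p l : ℕ} (hp : p.Prime) (hl : l.Prime) (f : (ZMod 2)⟦X⟧) :
    hecke p (hecke l f) = hecke l (hecke p f) := by
  rcases eq_or_ne p l with rfl | hpl
  · rfl
  have hcop : p.Coprime l := (Nat.coprime_primes hp hl).2 hpl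
  ext n
  have e1 : l ∣ p * n ↔ l ∣ n := hcop.symm.dvd_mul_left
  have e2 : p ∣ l * n ↔ p ∣ n := hcop.dvd_mul_left
  simp only [coeff_hecke, e1, e2]
  rw [mul_left_comm l p n]
  by_cases hpn : p ∣ n
  · obtain ⟨m, rfl⟩ := hpn
    have h1 : l ∣ p * m ↔ l ∣ m := hcop.symm.dvd_mul_left
    simp only [h1, Nat.mul_div_cancel_left _ hp.pos, dvd_mul_right, if_true]
    by_cases hlm : l ∣ m
    · obtain ⟨k, rfl⟩ := hlm
      have a1 : p * (l * k) / l = p * k := by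
        rw [mul_left_comm, Nat.mul_div_cancel_left _ hl.pos]
      have a2 : p * (p * (l * k)) / l = p * (p * k) := by
        rw [mul_left_comm p l k, mul_left_comm p l, Nat.mul_div_cancel_left _ hl.pos]
      have a3 : l * (p * (l * k)) / p = l * (l * k) := by
        rw [mul_left_comm l p, Nat.mul_div_cancel_left _ hp.pos]
      simp only [dvd_mul_right, if_true, Nat.mul_div_cancel_left _ hl.pos, a1, a2, a3,
        Nat.mul_div_cancel_left _ hp.pos]
      ring
    · have a3 : l * (p * m) / p = l * m := by
        rw [mul_left_comm l p, Nat.mul_div_cancel_left _ hp.pos]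
      simp only [if_neg hlm, a3]
      ring
  · by_cases hln : l ∣ n
    · obtain ⟨m, rfl⟩ := hln
      have h1 : p ∣ m ↔ p ∣ l * m := hcop.dvd_mul_left.symm
      have a1 : p * (l * m) / l = p * m := by
        rw [mul_left_comm, Nat.mul_div_cancel_left _ hl.pos]
      simp only [if_neg hpn, h1, dvd_mul_right, if_true, a1, Nat.mul_div_cancel_left _ hl.pos]
      ring
    · simp only [if_neg hpn, if_neg hln]

/-- Squaring is the substitution `q ↦ q ^ 2`, which commutes with `T_p` because `p` is odd. -/
theorem hecke_sq {p : ℕ} (hp : Odd p) (f : (ZMod 2)⟦X⟧) : hecke p (f ^ 2) = hecke p f ^ 2 := by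
  have hp0 : p ≠ 0 := by rintro rfl; simp at hp
  have hcop : Nat.Coprime 2 p := (Nat.coprime_two_left).2 hp
  rw [sq_eq_expand, sq_eq_expand]
  ext n
  rw [coeff_hecke, coeff_expand, coeff_expand, coeff_expand]
  have e2 : 2 ∣ p * n ↔ 2 ∣ n := hcop.dvd_mul_left
  by_cases hn : 2 ∣ n
  · obtain ⟨m, rfl⟩ := hn
    have a1 : p * (2 * m) / 2 = p * m := by
      rw [mul_left_comm, Nat.mul_div_cancel_left _ two_pos]
    have e3 : p ∣ 2 * m ↔ p ∣ m := hcop.symm.dvd_mul_left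
    simp only [e2, dvd_mul_right, if_true, a1, Nat.mul_div_cancel_left _ two_pos, coeff_hecke, e3]
    congr 1
    split_ifs with h1 h2
    · obtain ⟨k, rfl⟩ := h1
      rw [mul_left_comm, Nat.mul_div_cancel_left _ (Nat.pos_of_ne_zero hp0),
        Nat.mul_div_cancel_left _ two_pos, Nat.mul_div_cancel_left _ (Nat.pos_of_ne_zero hp0)]
    · obtain ⟨k, rfl⟩ := h1
      rw [mul_left_comm, Nat.mul_div_cancel_left _ (Nat.pos_of_ne_zero hp0)] at h2
      exact absurd (dvd_mul_right _ _) h2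
    · rfl
  · have e4 : ∀ (_ : p ∣ n), ¬ 2 ∣ n / p := by
      rintro ⟨k, rfl⟩ h
      rw [Nat.mul_div_cancel_left _ (Nat.pos_of_ne_zero hp0)] at h
      exact hn (h.mul_left p)
    rw [if_neg (fun h => hn (e2.1 h)), if_neg hn, zero_add]
    split_ifs with h1 h2
    · exact absurd h2 (e4 h1)
    · rfl
    · rfl

theorem coeff_Delta (n : ℕ) [Decidable (∃ m : ℕ, n = (2 * m + 1) ^ 2)] :
    coeff n Delta = if ∃ m : ℕ, n = (2 * m + 1) ^ 2 then 1 else 0 := by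
  rw [Delta, coeff_mk]
  congr

/-- The coefficients at `p * n` and at `n / p` agree, since `p * n` is an odd square exactly when
`n / p` is one. -/
theorem hecke_Delta {p : ℕ} (hp : p.Prime) (hodd : Odd p) : hecke p Delta = 0 := by
  classical
  ext n
  have key : (∃ m : ℕ, p * n = (2 * m + 1) ^ 2) ↔ (p ∣ n ∧ ∃ m : ℕ, n / p = (2 * m + 1) ^ 2) := by
    constructor
    · rintro ⟨m, hm⟩
      obtain ⟨c, hc⟩ : p ∣ 2 * m + 1 := hp.dvd_of_dvd_pow ⟨n, hm.symm⟩
      have hn : n = p * c ^ 2 := by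
        refine Nat.eq_of_mul_eq_mul_left hp.pos ?_
        rw [hm, hc]; ring
      have hcodd : Odd c := by
        have : Odd (p * c) := ⟨m, hc.symm⟩
        exact (Nat.odd_mul.1 this).2
      obtain ⟨d, rfl⟩ := hcodd
      exact ⟨⟨_, hn⟩, d, by rw [hn, Nat.mul_div_cancel_left _ hp.pos]⟩
    · rintro ⟨⟨c, rfl⟩, m, hm⟩
      rw [Nat.mul_div_cancel_left _ hp.pos] at hm
      obtain ⟨d, hd⟩ := hodd.mul (⟨m, rfl⟩ : Odd (2 * m + 1))
      exact ⟨d, by rw [← hd, hm]; ring⟩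
  rw [coeff_hecke, coeff_Delta, coeff_Delta, map_zero]
  by_cases h : p ∣ n
  · simp only [key, h, true_and, if_true]
    exact CharTwo.add_self_eq_zero _
  · simp [key, h]

end

/-! ### The classical Hecke operator of level one -/

section

open UpperHalfPlane ModularForm MatrixGroups Function
open scoped ModularForm Manifold

theorem coe_SL_apply (γ : SL(2, ℤ)) (i j : Fin 2) :
    ((γ : GL (Fin 2) ℝ) : Matrix (Fin 2) (Fin 2) ℝ) i j = ((γ.1 i j : ℤ) : ℝ) := rfl

/-- The matrix `!![1, a; 0, p]`. -/
noncomputable def upperMat (p : ℕ) [NeZero p] (a : ℤ) : GL (Fin 2) ℝ :=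
  Matrix.GeneralLinearGroup.mkOfDetNeZero !![1, (a : ℝ); 0, (p : ℝ)]
    (by simp [Matrix.det_fin_two, NeZero.ne p])

/-- The matrix `!![p, 0; 0, 1]`. -/
noncomputable def diagMat (p : ℕ) [NeZero p] : GL (Fin 2) ℝ :=
  Matrix.GeneralLinearGroup.mkOfDetNeZero !![(p : ℝ), 0; 0, 1]
    (by simp [Matrix.det_fin_two, NeZero.ne p])

section
variable {p : ℕ} [NeZero p] {k : ℤ}

/-- A form of level one has the same slash translates by `A` and by `B` if `A = γ * B` for some
`γ ∈ SL(2, ℤ)`. -/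
theorem slash_eq_of_mul_eq (f : ModularForm 𝒮ℒ k) {a b c d : ℤ} (hdet : a * d - b * c = 1)
    {A B : GL (Fin 2) ℝ}
    (hAB : (A : Matrix (Fin 2) (Fin 2) ℝ) = !![(a : ℝ), b; c, d] * B) :
    (f : ℍ → ℂ) ∣[k] A = (f : ℍ → ℂ) ∣[k] B := by
  set γ : SL(2, ℤ) := ⟨!![a, b; c, d], by rw [Matrix.det_fin_two_of, hdet]⟩ with hγ
  have h : A = (γ : GL (Fin 2) ℝ) * B := by
    refine Units.ext ?_
    rw [hAB, Units.val_mul]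
    congr 1
    ext i j
    rw [coe_SL_apply]
    fin_cases i <;> fin_cases j <;> rfl
  rw [h, SlashAction.slash_mul]
  congr 1
  exact SlashInvariantFormClass.slash_action_eq f _ ⟨γ, rfl⟩

theorem slash_upperMat_add (f : ModularForm 𝒮ℒ k) (a m : ℤ) :
    (f : ℍ → ℂ) ∣[k] upperMat p (a + p * m) = (f : ℍ → ℂ) ∣[k] upperMat p a := by
  refine slash_eq_of_mul_eq f (a := 1) (b := m) (c := 0) (d := 1) (by ring) ?_
  ext i j
  simp only [Matrix.mul_apply, Fin.sum_univ_two]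
  fin_cases i <;> fin_cases j <;> simp [upperMat, mul_comm, add_comm]

theorem slash_upperMat_congr (f : ModularForm 𝒮ℒ k) {a b : ℤ} (hab : (a : ZMod p) = b) :
    (f : ℍ → ℂ) ∣[k] upperMat p a = (f : ℍ → ℂ) ∣[k] upperMat p b := by
  obtain ⟨m, hm⟩ := (ZMod.intCast_eq_intCast_iff_dvd_sub b a p).1 hab.symm
  rw [show a = b + p * m by linarith, slash_upperMat_add]

/-- The classical Hecke operator `T_p`: the sum of the slash translates of `f` over representatives
of the integral matrices of determinant `p` modulo `SL(2, ℤ)`. -/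
noncomputable def heckeSum (p : ℕ) [NeZero p] (f : ModularForm 𝒮ℒ k) : ℍ → ℂ :=
  ∑ a : ZMod p, (f : ℍ → ℂ) ∣[k] upperMat p (a.val : ℤ) + (f : ℍ → ℂ) ∣[k] diagMat p

theorem slash_upperMat_T (f : ModularForm 𝒮ℒ k) (a : ℤ) :
    ((f : ℍ → ℂ) ∣[k] upperMat p a) ∣[k] ((ModularGroup.T : SL(2, ℤ)) : GL (Fin 2) ℝ) =
      (f : ℍ → ℂ) ∣[k] upperMat p (a + 1) := by
  rw [← SlashAction.slash_mul]
  congr 1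
  ext i j
  simp only [Matrix.GeneralLinearGroup.coe_mul, Matrix.mul_apply, Fin.sum_univ_two, coe_SL_apply]
  fin_cases i <;> fin_cases j <;>
    simp [upperMat, ModularGroup.T, add_comm]

theorem slash_diagMat_T (f : ModularForm 𝒮ℒ k) :
    ((f : ℍ → ℂ) ∣[k] diagMat p) ∣[k] ((ModularGroup.T : SL(2, ℤ)) : GL (Fin 2) ℝ) =
      (f : ℍ → ℂ) ∣[k] diagMat p := by
  rw [← SlashAction.slash_mul]
  refine slash_eq_of_mul_eq f (a := 1) (b := p) (c := 0) (d := 1) (by ring) ?_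
  ext i j
  simp only [Matrix.GeneralLinearGroup.coe_mul, Matrix.mul_apply, Fin.sum_univ_two, coe_SL_apply]
  fin_cases i <;> fin_cases j <;>
    simp [diagMat, ModularGroup.T]

theorem slash_diagMat_S (f : ModularForm 𝒮ℒ k) :
    ((f : ℍ → ℂ) ∣[k] diagMat p) ∣[k] ((ModularGroup.S : SL(2, ℤ)) : GL (Fin 2) ℝ) =
      (f : ℍ → ℂ) ∣[k] upperMat p 0 := by
  rw [← SlashAction.slash_mul]
  refine slash_eq_of_mul_eq f (a := 0) (b := -1) (c := 1) (d := 0) (by ring) ?_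
  ext i j
  simp only [Matrix.GeneralLinearGroup.coe_mul, Matrix.mul_apply, Fin.sum_univ_two, coe_SL_apply]
  fin_cases i <;> fin_cases j <;>
    simp [diagMat, upperMat, ModularGroup.S]

theorem slash_upperMat_zero_S (f : ModularForm 𝒮ℒ k) :
    ((f : ℍ → ℂ) ∣[k] upperMat p 0) ∣[k] ((ModularGroup.S : SL(2, ℤ)) : GL (Fin 2) ℝ) =
      (f : ℍ → ℂ) ∣[k] diagMat p := by
  rw [← SlashAction.slash_mul]
  refine slash_eq_of_mul_eq f (a := 0) (b := -1) (c := 1) (d := 0) (by ring) ?_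
  ext i j
  simp only [Matrix.GeneralLinearGroup.coe_mul, Matrix.mul_apply, Fin.sum_univ_two, coe_SL_apply]
  fin_cases i <;> fin_cases j <;>
    simp [diagMat, upperMat, ModularGroup.S]

theorem slash_upperMat_S (f : ModularForm 𝒮ℒ k) {a b : ℤ} (hab : (p : ℤ) ∣ 1 + a * b) :
    ((f : ℍ → ℂ) ∣[k] upperMat p a) ∣[k] ((ModularGroup.S : SL(2, ℤ)) : GL (Fin 2) ℝ) =
      (f : ℍ → ℂ) ∣[k] upperMat p b := by
  obtain ⟨c, hc⟩ := hab
  rw [← SlashAction.slash_mul]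
  refine slash_eq_of_mul_eq f (a := a) (b := -c) (c := p) (d := -b) (by linarith) ?_
  have hc' : (1 : ℝ) + a * b = p * c := by exact_mod_cast hc
  ext i j
  simp only [Matrix.GeneralLinearGroup.coe_mul, Matrix.mul_apply, Fin.sum_univ_two, coe_SL_apply]
  fin_cases i <;> fin_cases j <;>
    simp [upperMat, ModularGroup.S] <;> linarith

theorem heckeSum_slash_T (f : ModularForm 𝒮ℒ k) :
    heckeSum p f ∣[k] ModularGroup.T = heckeSum p f := by
  rw [SL_slash, heckeSum, SlashAction.add_slash, SlashAction.sum_slash, slash_diagMat_T]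
  congr 1
  simp only [slash_upperMat_T]
  refine Fintype.sum_equiv (Equiv.addRight (1 : ZMod p)) _ _ fun a => ?_
  exact slash_upperMat_congr f (by simp)

/-- The matrix `S` exchanges `upperMat p 0` and `diagMat p` up to `SL(2, ℤ)`, and sends
`upperMat p a` to `upperMat p (-a⁻¹)` for `a ≠ 0` modulo `p`. -/
theorem heckeSum_slash_S [Fact p.Prime] (f : ModularForm 𝒮ℒ k) :
    heckeSum p f ∣[k] ModularGroup.S = heckeSum p f := by
  classical
  rw [SL_slash, heckeSum, SlashAction.add_slash, SlashAction.sum_slash, slash_diagMat_S,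
    ← Finset.add_sum_erase _ _ (Finset.mem_univ (0 : ZMod p)),
    ← Finset.add_sum_erase _ _ (Finset.mem_univ (0 : ZMod p))]
  simp only [ZMod.val_zero, Nat.cast_zero]
  rw [slash_upperMat_zero_S]
  have : ∑ a ∈ Finset.univ.erase (0 : ZMod p), ((f : ℍ → ℂ) ∣[k] upperMat p (a.val : ℤ)) ∣[k]
        ((ModularGroup.S : SL(2, ℤ)) : GL (Fin 2) ℝ) =
      ∑ a ∈ Finset.univ.erase (0 : ZMod p), (f : ℍ → ℂ) ∣[k] upperMat p (a.val : ℤ) := by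
    refine Finset.sum_nbij' (fun a => -a⁻¹) (fun a => -a⁻¹) ?_ ?_ ?_ ?_ ?_
    · intro a; simp
    · intro a; simp
    · intro a; simp [inv_neg]
    · intro a; simp [inv_neg]
    · intro a ha
      have ha0 : a ≠ 0 := Finset.ne_of_mem_erase ha
      refine slash_upperMat_S f ((ZMod.intCast_zmod_eq_zero_iff_dvd _ _).1 ?_)
      push_cast
      simp [ha0]
  rw [this]
  abel

/-- The classical Hecke operator `T_p` as an operation on modular forms of level one. -/
noncomputable def heckeForm (p : ℕ) [NeZero p] [Fact p.Prime] (f : ModularForm 𝒮ℒ k) :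
    ModularForm 𝒮ℒ k where
  toFun := heckeSum p f
  slash_action_eq' := by
    rintro _ ⟨γ, rfl⟩
    exact SlashInvariantForm.slash_action_generators_SL2Z (heckeSum_slash_S f)
      (heckeSum_slash_T f) γ
  holo' := by
    refine MDifferentiable.add (MDifferentiable.sum fun a _ => ?_) ?_ <;>
      exact (ModularFormClass.holo f).slash k _
  bdd_at_cusps' := by
    intro c hc
    rw [Subgroup.IsArithmetic.isCusp_iff_isCusp_SL2Z] at hc
    rw [OnePoint.isBoundedAt_iff_forall_SL2Z hc]
    intro γ _
    rw [SlashInvariantForm.slash_action_generators_SL2Z (heckeSum_slash_S f)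
      (heckeSum_slash_T f) γ]
    have hf := ModularFormClass.bdd_at_infty f
    have hM : ∀ M : GL (Fin 2) ℝ, M 1 0 = 0 → IsBoundedAtImInfty ((f : ℍ → ℂ) ∣[k] M) :=
      fun M hM => IsBoundedAtImInfty.slash (k := k) (g := M) hM hf
    refine Filter.BoundedAtFilter.add ?_ (hM _ (by simp [diagMat]))
    rw [Filter.BoundedAtFilter, Finset.sum_fn]
    exact .fun_sum fun a _ => hM _ (by simp [upperMat])

end

end

/-! ### The classical Hecke operator on `q`-expansions -/

section

open UpperHalfPlane ModularForm MatrixGroups Function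
open scoped ModularForm Manifold

section
variable {p : ℕ} [NeZero p] {k : ℤ}

theorem hasSum_slash_diagMat (f : ModularForm 𝒮ℒ k) (τ : ℍ) :
    HasSum (fun n => (p : ℂ) ^ (k - 1) * (qExpansion 1 f).coeff n * Periodic.qParam 1 τ ^ (p * n))
      (((f : ℍ → ℂ) ∣[k] diagMat p) τ) := by
  have hp : (0 : ℝ) < p := Nat.cast_pos.2 (NeZero.pos p)
  have hdet : 0 < (diagMat p).det.val := by simp [diagMat, Matrix.det_fin_two, hp]
  have hval : ((f : ℍ → ℂ) ∣[k] diagMat p) τ = (p : ℂ) ^ (k - 1) * f (diagMat p • τ) := by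
    rw [slash_apply, σ, if_pos hdet]
    simp [denom, diagMat, Matrix.det_fin_two, mul_comm]
  rw [hval]
  have hq : Periodic.qParam 1 (diagMat p • τ : ℍ) = Periodic.qParam 1 τ ^ p := by
    rw [Periodic.qParam, Periodic.qParam, coe_smul_of_det_pos hdet, ← Complex.exp_nat_mul]
    congr 1
    simp [num, denom, diagMat]
    ring
  have := (ModularForm.hasSum_qExpansion (f := f) one_pos one_mem_strictPeriods_SL
    (diagMat p • τ)).mul_left ((p : ℂ) ^ (k - 1))
  simpa [hq, pow_mul, mul_assoc] using this

theorem hasSum_slash_upperMat (f : ModularForm 𝒮ℒ k) (a : ℕ) (τ : ℍ) :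
    HasSum (fun n => (p : ℂ)⁻¹ * (qExpansion 1 f).coeff n *
        Complex.exp (2 * Real.pi * Complex.I * τ / p) ^ n *
        (Complex.exp (2 * Real.pi * Complex.I / p) ^ n) ^ a)
      (((f : ℍ → ℂ) ∣[k] upperMat p a) τ) := by
  have hp : (0 : ℝ) < p := Nat.cast_pos.2 (NeZero.pos p)
  have hp' : (p : ℂ) ≠ 0 := NeZero.ne _
  have hdet : 0 < (upperMat p a).det.val := by simp [upperMat, Matrix.det_fin_two, hp]
  have hval : ((f : ℍ → ℂ) ∣[k] upperMat p a) τ = (p : ℂ)⁻¹ * f (upperMat p a • τ) := by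
    rw [slash_apply, σ, if_pos hdet]
    simp [denom, upperMat, Matrix.det_fin_two]
    rw [mul_assoc, ← zpow_neg, ← zpow_add₀ hp', mul_comm]
    congr 1
    rw [← zpow_neg_one]
    congr 1
    ring
  rw [hval]
  have hq : Periodic.qParam 1 (upperMat p a • τ : ℍ) =
      Complex.exp (2 * Real.pi * Complex.I * τ / p) *
        Complex.exp (2 * Real.pi * Complex.I / p) ^ a := by
    rw [Periodic.qParam, coe_smul_of_det_pos hdet, ← Complex.exp_nat_mul, ← Complex.exp_add]
    congr 1
    simp [num, denom, upperMat]
    field_simp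
  have := (ModularForm.hasSum_qExpansion (f := f) one_pos one_mem_strictPeriods_SL
    (upperMat p a • τ)).mul_left ((p : ℂ)⁻¹)
  simpa only [hq, mul_pow, mul_assoc, ← pow_mul, mul_comm a] using this

theorem sum_pow_zmod_val (ζ : ℂ) (hζ : IsPrimitiveRoot ζ p) (n : ℕ) :
    ∑ a : ZMod p, (ζ ^ n) ^ a.val = if p ∣ n then (p : ℂ) else 0 := by
  have h1 : ∑ a : ZMod p, (ζ ^ n) ^ a.val = ∑ i ∈ Finset.range p, (ζ ^ n) ^ i := by
    refine Finset.sum_nbij' (fun a => a.val) (fun i => (i : ZMod p)) ?_ ?_ ?_ ?_ ?_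
    · intro a _; simpa using ZMod.val_lt a
    · intro a _; simp
    · intro a _; simp
    · intro a ha; exact ZMod.val_cast_of_lt (by simpa using ha)
    · intro a _; rfl
  rw [h1]
  split_ifs with h
  · rw [(hζ.pow_eq_one_iff_dvd n).2 h]; simp
  · have hne : ζ ^ n ≠ 1 := fun h' => h ((hζ.pow_eq_one_iff_dvd n).1 h')
    rw [geom_sum_eq hne, ← pow_mul, mul_comm, pow_mul, hζ.pow_eq_one]
    simp

theorem hasSum_sum_slash_upperMat (f : ModularForm 𝒮ℒ k) (τ : ℍ) :
    HasSum (fun n => (qExpansion 1 f).coeff (p * n) * Periodic.qParam 1 τ ^ n)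
      ((∑ a : ZMod p, (f : ℍ → ℂ) ∣[k] upperMat p (a.val : ℤ)) τ) := by
  have hp' : (p : ℂ) ≠ 0 := NeZero.ne _
  have h1 := hasSum_sum (s := Finset.univ)
    (fun (a : ZMod p) (_ : a ∈ Finset.univ) => hasSum_slash_upperMat (p := p) f a.val τ)
  rw [← Finset.sum_apply] at h1
  simp only [← Finset.mul_sum, sum_pow_zmod_val _ (Complex.isPrimitiveRoot_exp p (NeZero.ne p))]
    at h1
  have hinj : Injective fun n : ℕ => p * n := fun a b hab =>
    Nat.eq_of_mul_eq_mul_left (NeZero.pos p) hab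
  rw [← hinj.hasSum_iff] at h1
  · convert! h1 using 2 with n
    have : Complex.exp (2 * Real.pi * Complex.I * τ / p) ^ p = Periodic.qParam 1 τ := by
      rw [← Complex.exp_nat_mul, Periodic.qParam]
      congr 1
      field_simp
      simp
    simp [pow_mul, this]
    field_simp
  · intro n hn
    rw [if_neg, mul_zero]
    rintro ⟨m, rfl⟩
    exact hn ⟨m, rfl⟩

/-- The effect of the Hecke operator on `q`-expansions. -/
theorem qExpansion_heckeForm_coeff [Fact p.Prime] (f : ModularForm 𝒮ℒ k) (n : ℕ) :
    (qExpansion 1 (heckeForm p f)).coeff n = (qExpansion 1 f).coeff (p * n) +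
      if p ∣ n then (p : ℂ) ^ (k - 1) * (qExpansion 1 f).coeff (n / p) else 0 := by
  symm
  refine ModularFormClass.qExpansion_coeff_unique one_pos one_mem_strictPeriods_SL
    (c := fun n => (qExpansion 1 f).coeff (p * n) +
      if p ∣ n then (p : ℂ) ^ (k - 1) * (qExpansion 1 f).coeff (n / p) else 0) (fun τ => ?_) n
  have h1 := hasSum_sum_slash_upperMat (p := p) f τ
  have h2 : HasSum (fun n => (if p ∣ n then (p : ℂ) ^ (k - 1) * (qExpansion 1 f).coeff (n / p)
      else 0) * Periodic.qParam 1 τ ^ n) (((f : ℍ → ℂ) ∣[k] diagMat p) τ) := by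
    have hinj : Injective fun n : ℕ => p * n := fun a b hab =>
      Nat.eq_of_mul_eq_mul_left (NeZero.pos p) hab
    rw [← hinj.hasSum_iff]
    · convert! hasSum_slash_diagMat (p := p) f τ using 2 with n
      simp [Nat.mul_div_cancel_left n (NeZero.pos p)]
    · intro n hn
      rw [if_neg, zero_mul]
      rintro ⟨m, rfl⟩
      exact hn ⟨m, rfl⟩
  have := h1.add h2
  simp only [smul_eq_mul, add_mul]
  exact this

end

end

/-! ### The discriminant form modulo `2` -/

section

open UpperHalfPlane ModularForm MatrixGroups EisensteinSeries
open scoped ArithmeticFunction.sigma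

/-- The generating series of the divisor sum `σ k`. -/
noncomputable def sigmaSeries (k : ℕ) : ℤ⟦X⟧ := PowerSeries.mk fun n => (σ k n : ℤ)

theorem qExpansion_E₄ : qExpansion 1 E₄ =
    PowerSeries.map (Int.castRingHom ℂ) (1 + 240 * sigmaSeries 3) := by
  ext n
  have h240 : (240 : ℤ⟦X⟧) = PowerSeries.C 240 := by simp
  rw [E_qExpansion_coeff _ ⟨2, rfl⟩, PowerSeries.coeff_map, map_add, PowerSeries.coeff_one, h240,
    PowerSeries.coeff_C_mul, sigmaSeries, PowerSeries.coeff_mk]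
  rcases eq_or_ne n 0 with rfl | hn
  · simp
  · norm_num [hn, show bernoulli 4 = -1 / 30 by decide +kernel]

theorem qExpansion_E₆ : qExpansion 1 E₆ =
    PowerSeries.map (Int.castRingHom ℂ) (1 - 504 * sigmaSeries 5) := by
  ext n
  have h504 : (504 : ℤ⟦X⟧) = PowerSeries.C 504 := by simp
  rw [E_qExpansion_coeff _ ⟨3, rfl⟩, PowerSeries.coeff_map, map_sub, PowerSeries.coeff_one, h504,
    PowerSeries.coeff_C_mul, sigmaSeries, PowerSeries.coeff_mk]
  rcases eq_or_ne n 0 with rfl | hn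
  · simp
  · norm_num [hn, show bernoulli 6 = 1 / 42 by decide +kernel]

/-- The `q`-expansion of the discriminant form, as an integral power series. It is the expression
`(E₄ ^ 3 - E₆ ^ 2) / 1728` with the division carried out. -/
noncomputable def discriminantInt : ℤ⟦X⟧ :=
  PowerSeries.mk (fun n => ∑ d ∈ n.divisors, (5 * (d : ℤ) ^ 3 + 7 * (d : ℤ) ^ 5) / 12) +
    100 * sigmaSeries 3 ^ 2 - 147 * sigmaSeries 5 ^ 2 + 8000 * sigmaSeries 3 ^ 3

theorem dvd_five_mul_cube_add (d : ℤ) : 24 ∣ 5 * d ^ 3 + 7 * d ^ 5 - 12 * d := by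
  refine (ZMod.intCast_zmod_eq_zero_iff_dvd _ 24).1 ?_
  push_cast
  generalize (d : ZMod 24) = x
  revert x; decide

theorem discriminantInt_eq : 1728 * discriminantInt =
    (1 + 240 * sigmaSeries 3) ^ 3 - (1 - 504 * sigmaSeries 5) ^ 2 := by
  have h : 12 * PowerSeries.mk
      (fun n => ∑ d ∈ n.divisors, (5 * (d : ℤ) ^ 3 + 7 * (d : ℤ) ^ 5) / 12) =
      5 * sigmaSeries 3 + 7 * sigmaSeries 5 := by
    ext n
    have h12 : (12 : ℤ⟦X⟧) = PowerSeries.C 12 := by simp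
    have h5 : (5 : ℤ⟦X⟧) = PowerSeries.C 5 := by simp
    have h7 : (7 : ℤ⟦X⟧) = PowerSeries.C 7 := by simp
    rw [h12, h5, h7, map_add, PowerSeries.coeff_C_mul, PowerSeries.coeff_C_mul,
      PowerSeries.coeff_C_mul, sigmaSeries, sigmaSeries, PowerSeries.coeff_mk, PowerSeries.coeff_mk,
      PowerSeries.coeff_mk, ArithmeticFunction.sigma_apply, ArithmeticFunction.sigma_apply]
    push_cast
    rw [Finset.mul_sum, Finset.mul_sum, Finset.mul_sum, ← Finset.sum_add_distrib]
    refine Finset.sum_congr rfl fun d _ => ?_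
    have := dvd_five_mul_cube_add d
    omega
  rw [discriminantInt]
  linear_combination 144 * h

/-- Obtained from `1728 * discriminant = E₄ ^ 3 - E₆ ^ 2`. -/
theorem qExpansion_discriminant : qExpansion 1 discriminant =
    PowerSeries.map (Int.castRingHom ℂ) discriminantInt := by
  have h1 : ((1728 : ℂ) • CuspForm.discriminant : ℍ → ℂ) =
      (E₄.pow 3 : ℍ → ℂ) - (E₆.pow 2 : ℍ → ℂ) := by
    ext z
    have := discriminant_eq_E₄_cube_sub_E₆_sq z
    simp only [Pi.smul_apply, CuspForm.coe_discriminant, smul_eq_mul, Pi.sub_apply, coe_pow,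
      Pi.pow_apply, this]
    ring
  have h2 := ModularForm.qExpansion_smul one_pos one_mem_strictPeriods_SL (1728 : ℂ)
    CuspForm.discriminant
  rw [h1, ModularForm.qExpansion_sub one_pos one_mem_strictPeriods_SL,
    ModularForm.qExpansion_pow one_pos one_mem_strictPeriods_SL,
    ModularForm.qExpansion_pow one_pos one_mem_strictPeriods_SL, qExpansion_E₄, qExpansion_E₆,
    ← map_pow, ← map_pow, ← map_sub, ← discriminantInt_eq, CuspForm.coe_discriminant] at h2
  have h3 : (1728 : ℂ) • PowerSeries.map (Int.castRingHom ℂ) discriminantInt =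
      (1728 : ℂ) • qExpansion 1 discriminant := by
    rw [← h2, map_mul, PowerSeries.smul_eq_C_mul, map_ofNat, map_ofNat]
  exact (smul_right_injective _ (by norm_num : (1728 : ℂ) ≠ 0) h3).symm

/-- Passing from `m` to `2 * m` only adds even divisors. -/
theorem sum_divisors_two_mul (m : ℕ) :
    ∑ d ∈ (2 * m).divisors, (d : ZMod 2) = ∑ d ∈ m.divisors, (d : ZMod 2) := by
  rcases eq_or_ne m 0 with rfl | hm
  · simp
  symm
  refine Finset.sum_subset (Nat.divisors_subset_of_dvd (by omega) (dvd_mul_left m 2)) ?_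
  intro d hd hd'
  rw [ZMod.natCast_eq_zero_iff]
  by_contra h2
  refine hd' (Nat.mem_divisors.2 ⟨?_, hm⟩)
  exact (((Nat.prime_two.coprime_iff_not_dvd).2 h2).symm.dvd_mul_left).1
    (Nat.dvd_of_mem_divisors hd)

/-- The number of divisors of an odd integer is odd exactly when the integer is a square, since
`d ↦ n / d` is an involution. -/
theorem sum_divisors_odd {n : ℕ} (hn : Odd n) [Decidable (∃ m : ℕ, n = (2 * m + 1) ^ 2)] :
    ∑ d ∈ n.divisors, (d : ZMod 2) = if ∃ m : ℕ, n = (2 * m + 1) ^ 2 then 1 else 0 := by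
  classical
  have hn0 : n ≠ 0 := by rintro rfl; simp at hn
  have hodd : ∀ d ∈ n.divisors, (d : ZMod 2) = 1 := fun d hd =>
    ZMod.natCast_eq_one_iff_odd.2 (Odd.of_dvd_nat hn (Nat.dvd_of_mem_divisors hd))
  have hfix : ∀ d ∈ n.divisors, n / d = d → ∃ m : ℕ, d = 2 * m + 1 ∧ n = (2 * m + 1) ^ 2 := by
    intro d hd h
    obtain ⟨m, hm⟩ := Odd.of_dvd_nat hn (Nat.dvd_of_mem_divisors hd)
    refine ⟨m, hm, ?_⟩
    rw [← hm, sq]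
    conv_rhs => rw [← h]
    conv_lhs => rw [← Nat.div_mul_cancel (Nat.dvd_of_mem_divisors hd)]
    rw [h]
  have hinv : ∀ s ⊆ n.divisors, (∀ d ∈ s, n / d ∈ s) → (∀ d ∈ s, n / d ≠ d) →
      ∑ d ∈ s, (d : ZMod 2) = 0 := by
    intro s hs h1 h2
    refine Finset.sum_involution (fun d _ => n / d) ?_ (fun d hd _ => h2 d hd) h1 ?_
    · intro d hd
      rw [hodd d (hs hd), hodd _ (hs (h1 d hd))]
      decide
    · intro d hd
      exact Nat.div_div_self (Nat.dvd_of_mem_divisors (hs hd)) hn0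
  split_ifs with h
  · obtain ⟨m, rfl⟩ := h
    have hmem : 2 * m + 1 ∈ ((2 * m + 1) ^ 2).divisors :=
      Nat.mem_divisors.2 ⟨dvd_pow_self _ two_ne_zero, hn0⟩
    rw [← Finset.add_sum_erase _ _ hmem, hodd _ hmem, hinv _ (Finset.erase_subset _ _), add_zero]
    · intro d hd
      obtain ⟨hd1, hd2⟩ := Finset.mem_erase.1 hd
      refine Finset.mem_erase.2 ⟨fun h => hd1 ?_, Nat.mem_divisors.2
        ⟨Nat.div_dvd_of_dvd (Nat.dvd_of_mem_divisors hd2), hn0⟩⟩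
      have := Nat.div_div_self (Nat.dvd_of_mem_divisors hd2) hn0
      rw [h, sq, Nat.mul_div_cancel _ (by omega)] at this
      exact this.symm
    · intro d hd h
      obtain ⟨hd1, hd2⟩ := Finset.mem_erase.1 hd
      obtain ⟨m', h1, h2⟩ := hfix d hd2 h
      have := Nat.pow_left_injective two_ne_zero h2
      omega
  · refine hinv _ subset_rfl ?_ ?_
    · intro d hd
      exact Nat.mem_divisors.2 ⟨Nat.div_dvd_of_dvd (Nat.dvd_of_mem_divisors hd), hn0⟩
    · intro d hd h'
      obtain ⟨m, -, h2⟩ := hfix d hd h'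
      exact h ⟨m, h2⟩

theorem map_sigmaSeries_five : PowerSeries.map (Int.castRingHom (ZMod 2)) (sigmaSeries 5) =
    PowerSeries.mk fun n => ∑ d ∈ n.divisors, (d : ZMod 2) := by
  ext n
  rw [PowerSeries.coeff_map, sigmaSeries, PowerSeries.coeff_mk, PowerSeries.coeff_mk,
    ArithmeticFunction.sigma_apply]
  push_cast
  rw [map_sum]
  refine Finset.sum_congr rfl fun d _ => ?_
  simp only [eq_intCast, Int.cast_pow, Int.cast_natCast]
  generalize (d : ZMod 2) = x
  revert x; decide

/-- The discriminant form reduces to `Delta` modulo `2`. -/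
theorem map_discriminantInt :
    PowerSeries.map (Int.castRingHom (ZMod 2)) discriminantInt = Delta := by
  classical
  set s : (ZMod 2)⟦X⟧ := PowerSeries.mk fun n => ∑ d ∈ n.divisors, (d : ZMod 2) with hs
  have h1 : PowerSeries.map (Int.castRingHom (ZMod 2)) (PowerSeries.mk
      (fun n => ∑ d ∈ n.divisors, (5 * (d : ℤ) ^ 3 + 7 * (d : ℤ) ^ 5) / 12)) = s := by
    ext n
    rw [PowerSeries.coeff_map, PowerSeries.coeff_mk, hs, PowerSeries.coeff_mk, map_sum]
    refine Finset.sum_congr rfl fun d _ => ?_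
    have := dvd_five_mul_cube_add d
    rw [eq_intCast, ← Int.cast_natCast (R := ZMod 2) d, ZMod.intCast_eq_intCast_iff_dvd_sub]
    push_cast
    omega
  have h2 : PowerSeries.map (Int.castRingHom (ZMod 2)) discriminantInt = s + s ^ 2 := by
    rw [discriminantInt, map_add, map_sub, map_add, map_mul, map_mul, map_mul, h1, map_pow,
      map_pow, map_pow, map_sigmaSeries_five, ← hs]
    simp only [map_ofNat]
    linear_combination (50 * (PowerSeries.map (Int.castRingHom (ZMod 2)) (sigmaSeries 3)) ^ 2 -
      74 * s ^ 2 + 4000 * (PowerSeries.map (Int.castRingHom (ZMod 2)) (sigmaSeries 3)) ^ 3) *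
      two_eq_zero_powerSeries
  rw [h2, sq_eq_expand]
  ext n
  rw [map_add, PowerSeries.coeff_expand, coeff_Delta, hs, PowerSeries.coeff_mk,
    PowerSeries.coeff_mk]
  rcases Nat.even_or_odd n with hn | hn
  · obtain ⟨m, rfl⟩ := hn.two_dvd
    rw [if_pos (dvd_mul_right 2 m), Nat.mul_div_cancel_left m two_pos, sum_divisors_two_mul,
      CharTwo.add_self_eq_zero, if_neg]
    rintro ⟨r, hr⟩
    have : Odd (2 * m) := hr ▸ Odd.pow (⟨r, rfl⟩ : Odd (2 * r + 1))
    exact (Nat.not_odd_iff_even.2 hn) this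
  · rw [if_neg (fun h => (Nat.not_even_iff_odd.2 hn) (even_iff_two_dvd.2 h)), add_zero,
      sum_divisors_odd hn]

end

/-! ### Stability of the polynomials in `Delta` -/

section

open UpperHalfPlane ModularForm MatrixGroups EisensteinSeries
open scoped ArithmeticFunction.sigma

theorem exists_isUnit_discriminantInt :
    ∃ U : (ℤ⟦X⟧)ˣ, discriminantInt = PowerSeries.X * (U : ℤ⟦X⟧) := by
  have hinj : Function.Injective (Int.castRingHom ℂ) := (Int.castRingHom ℂ).injective_int
  have hcoeff : ∀ n, Int.castRingHom ℂ (PowerSeries.coeff n discriminantInt) =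
      (qExpansion 1 discriminant).coeff n := fun n => by
    rw [qExpansion_discriminant, PowerSeries.coeff_map]
  have h0 : PowerSeries.coeff 0 discriminantInt = 0 := hinj <| by
    rw [hcoeff, map_zero]
    exact CuspFormClass.qExpansion_coeff_zero CuspForm.discriminant one_pos
      one_mem_strictPeriods_SL
  have h1 : PowerSeries.coeff 1 discriminantInt = 1 := hinj <| by
    rw [hcoeff, map_one, discriminant_qExpansion_coeff_one]
  obtain ⟨U, hU⟩ := PowerSeries.X_dvd_iff.2 (by simpa using h0)
  have hU1 : PowerSeries.constantCoeff U = 1 := by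
    rw [hU, ← zero_add 1, PowerSeries.coeff_succ_X_mul] at h1
    simpa using h1
  have hunit : IsUnit U := PowerSeries.isUnit_iff_constantCoeff.2 (by rw [hU1]; exact isUnit_one)
  obtain ⟨V, rfl⟩ := hunit
  exact ⟨V, hU⟩

/-- Subtracting a multiple of a power of `E₄` turns a form of level one into a multiple of the
discriminant form; on integral `q`-expansions both steps stay integral. -/
theorem exists_eq_add_discriminantInt_mul (k : ℕ) (f : ModularForm 𝒮ℒ (12 * (k : ℤ))) (P : ℤ⟦X⟧)
    (hP : qExpansion 1 f = PowerSeries.map (Int.castRingHom ℂ) P) :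
    ∃ (g : ModularForm 𝒮ℒ (12 * (k : ℤ) - 12)) (Q : ℤ⟦X⟧),
      qExpansion 1 g = PowerSeries.map (Int.castRingHom ℂ) Q ∧
      P = PowerSeries.C (PowerSeries.constantCoeff P) * (1 + 240 * sigmaSeries 3) ^ (3 * k) +
        discriminantInt * Q := by
  set c : ℤ := PowerSeries.constantCoeff P with hc
  set E : ModularForm 𝒮ℒ (12 * (k : ℤ)) :=
    ModularForm.mcast (by push_cast; ring) (E₄.pow (3 * k)) with hE
  have hEq : qExpansion 1 E = PowerSeries.map (Int.castRingHom ℂ)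
      ((1 + 240 * sigmaSeries 3) ^ (3 * k)) := by
    rw [hE, ModularForm.qExpansion_mcast _ rfl,
      ModularForm.qExpansion_pow one_pos one_mem_strictPeriods_SL, qExpansion_E₄, map_pow]
  set R : ℤ⟦X⟧ := P - PowerSeries.C c * (1 + 240 * sigmaSeries 3) ^ (3 * k) with hR
  set F : ModularForm 𝒮ℒ (12 * (k : ℤ)) := f - (c : ℂ) • E with hF
  have hfR : qExpansion 1 F = PowerSeries.map (Int.castRingHom ℂ) R := by
    have h1 := ModularForm.qExpansion_sub one_pos one_mem_strictPeriods_SL f ((c : ℂ) • E)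
    have h2 := ModularForm.qExpansion_smul one_pos one_mem_strictPeriods_SL (c : ℂ) E
    have h3 : qExpansion 1 F = qExpansion 1 f - (c : ℂ) • qExpansion 1 E := by
      rw [← h2]; exact h1
    rw [h3, hP, hEq, hR, map_sub, map_mul, PowerSeries.map_C, PowerSeries.smul_eq_C_mul]
    simp
  have hR0 : PowerSeries.constantCoeff R = 0 := by
    rw [hR, map_sub, map_mul, map_pow]
    simp [sigmaSeries, ← hc]
  have hf0 : (qExpansion 1 F).coeff 0 = 0 := by
    rw [hfR, PowerSeries.coeff_map]
    simp [hR0]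
  obtain ⟨R₁, hR₁⟩ := PowerSeries.X_dvd_iff.2 hR0
  obtain ⟨U, hU⟩ := exists_isUnit_discriminantInt
  have hQ : R = discriminantInt * ((U⁻¹ : (ℤ⟦X⟧)ˣ) * R₁) := by
    rw [hU, mul_assoc, ← mul_assoc (U : ℤ⟦X⟧), Units.mul_inv, one_mul, hR₁]
  refine ⟨CuspForm.discriminantEquiv (toCuspForm F hf0), (U⁻¹ : (ℤ⟦X⟧)ˣ) * R₁, ?_, ?_⟩
  · have h := qExpansion_eq_qExpansion_discriminant_mul _ hf0
    rw [hfR, hQ, map_mul, qExpansion_discriminant] at h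
    refine (mul_left_cancel₀ ?_ h).symm
    rw [← qExpansion_discriminant]
    intro h0
    have := discriminant_qExpansion_coeff_one
    rw [h0] at this
    simp at this
  · rw [← hQ, hR]; ring

/-- Integral modular forms of level one and weight divisible by `12` reduce modulo `2` to
polynomials in `Delta`. -/
theorem map_mem_adjoin_Delta (k : ℕ) (f : ModularForm 𝒮ℒ (12 * (k : ℤ))) (P : ℤ⟦X⟧)
    (hP : qExpansion 1 f = PowerSeries.map (Int.castRingHom ℂ) P) :
    PowerSeries.map (Int.castRingHom (ZMod 2)) P ∈ Algebra.adjoin (ZMod 2) {Delta} := by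
  have hred : ∀ (c : ℤ) (m : ℕ), PowerSeries.map (Int.castRingHom (ZMod 2))
      (PowerSeries.C c * (1 + 240 * sigmaSeries 3) ^ m) ∈ Algebra.adjoin (ZMod 2) {Delta} := by
    intro c m
    have h240 : (240 : (ZMod 2)⟦X⟧) = 0 := by linear_combination 120 * two_eq_zero_powerSeries
    rw [map_mul, map_pow, map_add, map_mul, PowerSeries.map_C, map_one, map_ofNat, h240, zero_mul,
      add_zero, one_pow, mul_one]
    exact Subalgebra.algebraMap_mem (Algebra.adjoin (ZMod 2) {Delta}) _
  induction k generalizing P with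
  | zero =>
    obtain ⟨g, Q, hg, hPQ⟩ := exists_eq_add_discriminantInt_mul 0 f P hP
    have hg0 : (g : ℍ → ℂ) = 0 := ModularFormClass.levelOne_neg_weight_eq_zero (by simp) g
    have hQ : Q = 0 := by
      rw [hg0, qExpansion_zero] at hg
      exact PowerSeries.map_injective (Int.castRingHom ℂ) (Int.castRingHom ℂ).injective_int
        (by rw [← hg, map_zero])
    rw [hPQ, hQ, mul_zero discriminantInt, add_zero]
    exact hred _ _
  | succ k ih =>
    obtain ⟨g, Q, hg, hPQ⟩ := exists_eq_add_discriminantInt_mul (k + 1) f P hP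
    have := ih (ModularForm.mcast (by push_cast; ring) g) Q
      ((ModularForm.qExpansion_mcast _ rfl g).trans hg)
    rw [hPQ, map_add, map_mul _ discriminantInt, map_discriminantInt]
    exact add_mem (hred _ _) (mul_mem (Algebra.self_mem_adjoin_singleton _ _) this)

/-- Every Hecke operator `T_p`, `p` an odd prime, maps powers of `Delta` to polynomials in
`Delta`: it is the reduction of the classical Hecke operator in weight `12 k`. -/
theorem hecke_Delta_pow_mem_adjoin {p : ℕ} (hp : p.Prime) (hodd : Odd p) (k : ℕ) :
    hecke p (Delta ^ k) ∈ Algebra.adjoin (ZMod 2) {Delta} := by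
  have : Fact p.Prime := ⟨hp⟩
  have : NeZero p := ⟨hp.ne_zero⟩
  rcases Nat.eq_zero_or_pos k with rfl | hk
  · rw [pow_zero, hecke_one hp.ne_zero]
    exact zero_mem _
  set f : ModularForm 𝒮ℒ (12 * (k : ℤ)) :=
    ModularForm.mcast (by ring) ((CuspForm.discriminant : ModularForm 𝒮ℒ 12).pow k) with hf
  have hfq : qExpansion 1 f = PowerSeries.map (Int.castRingHom ℂ) (discriminantInt ^ k) := by
    rw [hf, ModularForm.qExpansion_mcast _ rfl,
      ModularForm.qExpansion_pow one_pos one_mem_strictPeriods_SL, map_pow,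
      ← qExpansion_discriminant]
    rfl
  have hexp : (12 * (k : ℤ) - 1) = ((12 * k - 1 : ℕ) : ℤ) := by omega
  set P : ℤ⟦X⟧ := PowerSeries.mk fun n => PowerSeries.coeff (p * n) (discriminantInt ^ k) +
    if p ∣ n then (p : ℤ) ^ (12 * k - 1) * PowerSeries.coeff (n / p) (discriminantInt ^ k) else 0
    with hPdef
  have hP : qExpansion 1 (heckeForm p f) = PowerSeries.map (Int.castRingHom ℂ) P := by
    ext n
    rw [qExpansion_heckeForm_coeff, hfq, PowerSeries.coeff_map, PowerSeries.coeff_map,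
      PowerSeries.coeff_map, hPdef, PowerSeries.coeff_mk, map_add, hexp, zpow_natCast]
    congr 1
    split_ifs
    · simp
    · simp
  have hmem := map_mem_adjoin_Delta k (heckeForm p f) P hP
  convert! hmem using 1
  ext n
  rw [coeff_hecke, PowerSeries.coeff_map, hPdef, PowerSeries.coeff_mk, map_add,
    ← map_discriminantInt, ← map_pow, PowerSeries.coeff_map, PowerSeries.coeff_map]
  congr 1
  split_ifs
  · have : (p : ZMod 2) = 1 := ZMod.natCast_eq_one_iff_odd.2 hodd
    simp [this]
  · simp

end

/-! ### Theta series modulo `2` and representations by binary quadratic forms -/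

section

open PowerSeries Finset.HasAntidiagonal

theorem card_eq_zero_of_involution {α : Type*} (s : Finset α) (g : α → α)
    (hmem : ∀ a ∈ s, g a ∈ s) (hinv : ∀ a ∈ s, g (g a) = a) (hfix : ∀ a ∈ s, g a ≠ a) :
    (s.card : ZMod 2) = 0 := by
  rw [Finset.cast_card]
  exact Finset.sum_involution (fun a _ => g a) (fun _ _ => by decide) (fun a ha _ => hfix a ha)
    hmem hinv

open Classical in
/-- The pairs `(x, y)` of integers with `x ^ 2 + m * y ^ 2 = N` that satisfy `R`. For `m > 0` the
restriction to a box loses no solution, see `mem_reps`. -/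
noncomputable def reps (m N : ℕ) (R : ℤ → ℤ → Prop) : Finset (ℤ × ℤ) :=
  (Finset.Icc (-(N : ℤ)) N ×ˢ Finset.Icc (-(N : ℤ)) N).filter
    fun z => R z.1 z.2 ∧ z.1 ^ 2 + m * z.2 ^ 2 = N

theorem mem_reps {m N : ℕ} (hm : 0 < m) {R : ℤ → ℤ → Prop} {z : ℤ × ℤ} :
    z ∈ reps m N R ↔ R z.1 z.2 ∧ z.1 ^ 2 + m * z.2 ^ 2 = N := by
  obtain ⟨x, y⟩ := z
  simp only [reps, Finset.mem_filter, Finset.mem_product, Finset.mem_Icc, and_iff_right_iff_imp]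
  rintro ⟨-, h⟩
  have hm' : (1 : ℤ) ≤ m := by exact_mod_cast hm
  have hx := sq_nonneg x
  have hy : y ^ 2 ≤ m * y ^ 2 := le_mul_of_one_le_left (sq_nonneg y) hm'
  have hy0 := sq_nonneg y
  have h1 := Int.le_self_sq x
  have h2 := Int.le_self_sq (-x)
  have h3 := Int.le_self_sq y
  have h4 := Int.le_self_sq (-y)
  rw [neg_sq] at h2 h4
  constructor <;> constructor <;> linarith

open Classical in
/-- The integers with square `n` that satisfy `P`. -/
noncomputable def sqrts (P : ℤ → Prop) (n : ℕ) : Finset ℤ :=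
  (Finset.Icc (-(n : ℤ)) n).filter fun a => P a ∧ a ^ 2 = n

theorem mem_sqrts {P : ℤ → Prop} {n : ℕ} {a : ℤ} : a ∈ sqrts P n ↔ P a ∧ a ^ 2 = n := by
  simp only [sqrts, Finset.mem_filter, Finset.mem_Icc, and_iff_right_iff_imp]
  rintro ⟨-, h⟩
  have h1 := Int.le_self_sq a
  have h2 := Int.le_self_sq (-a)
  rw [neg_sq] at h2
  constructor <;> linarith

/-- The theta series `∑ q ^ (a ^ 2)` modulo `2`, over the integers `a` that satisfy `P`. -/
noncomputable def theta (P : ℤ → Prop) : (ZMod 2)⟦X⟧ :=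
  PowerSeries.mk fun n => ((sqrts P n).card : ZMod 2)

theorem coeff_theta (P : ℤ → Prop) (n : ℕ) : coeff n (theta P) = ((sqrts P n).card : ZMod 2) :=
  coeff_mk n fun n => ((sqrts P n).card : ZMod 2)

theorem coeff_expand_theta {m : ℕ} (hm : m ≠ 0) (P : ℤ → Prop) (n : ℕ) :
    coeff n (expand m hm (theta P)) = ((reps m n fun x y => x = 0 ∧ P y).card : ZMod 2) := by
  rw [coeff_expand, coeff_theta]
  split_ifs with h
  · obtain ⟨k, rfl⟩ := h
    rw [Nat.mul_div_cancel_left _ (Nat.pos_of_ne_zero hm)]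
    congr 1
    refine Finset.card_nbij' (fun y => (0, y)) (fun z => z.2) ?_ ?_ ?_ ?_
    · intro y hy
      obtain ⟨h1, h2⟩ := mem_sqrts.1 hy
      refine (mem_reps (Nat.pos_of_ne_zero hm)).2 ⟨⟨rfl, h1⟩, ?_⟩
      push_cast
      rw [h2]; ring
    · rintro ⟨x, y⟩ hz
      obtain ⟨⟨h0, h1⟩, h2⟩ := (mem_reps (Nat.pos_of_ne_zero hm)).1 hz
      refine mem_sqrts.2 ⟨h1, ?_⟩
      simp only at h0 h1 h2 ⊢
      subst h0
      push_cast at h2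
      have : (m : ℤ) ≠ 0 := by exact_mod_cast hm
      exact mul_left_cancel₀ this (by linarith)
    · intro y _; rfl
    · rintro ⟨x, y⟩ hz
      obtain ⟨⟨h0, h1⟩, h2⟩ := (mem_reps (Nat.pos_of_ne_zero hm)).1 hz
      simp only at h0
      rw [h0]
  · rw [Finset.card_eq_zero.2, Nat.cast_zero]
    refine Finset.eq_empty_of_forall_notMem fun z hz => h ?_
    obtain ⟨⟨h0, h1⟩, h2⟩ := (mem_reps (Nat.pos_of_ne_zero hm)).1 hz
    rw [h0] at h2
    exact Int.natCast_dvd_natCast.1 ⟨z.2 ^ 2, by linarith⟩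

/-- The product of theta series `∑ q ^ (x ^ 2)` and `∑ q ^ (m * y ^ 2)` counts representations by
`x ^ 2 + m * y ^ 2`. -/
theorem coeff_theta_mul_expand_theta {m : ℕ} (hm : m ≠ 0) (P Q : ℤ → Prop) (N : ℕ) :
    coeff N (theta P * expand m hm (theta Q)) =
      ((reps m N fun x y => P x ∧ Q y).card : ZMod 2) := by
  classical
  have hm' := Nat.pos_of_ne_zero hm
  rw [coeff_mul, Finset.card_eq_sum_card_fiberwise (t := antidiagonal N)
    (f := fun z => (z.1.natAbs ^ 2, m * z.2.natAbs ^ 2)), Nat.cast_sum]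
  · refine Finset.sum_congr rfl ?_
    rintro ⟨i, j⟩ hij
    rw [mem_antidiagonal] at hij
    simp only at hij
    rw [coeff_theta, coeff_expand_theta, ← Nat.cast_mul, ← Finset.card_product]
    congr 1
    refine Finset.card_nbij' (fun z => (z.1, z.2.2)) (fun z => (z.1, (0, z.2))) ?_ ?_ ?_ ?_
    · rintro ⟨a, x, b⟩ hz
      obtain ⟨h1, h2⟩ := Finset.mem_product.1 hz
      rw [mem_sqrts] at h1
      rw [mem_reps hm'] at h2
      obtain ⟨⟨hx, hb⟩, h3⟩ := h2
      simp only at hx hb h3 h1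
      subst hx
      refine Finset.mem_filter.2 ⟨(mem_reps hm').2 ⟨⟨h1.1, hb⟩, ?_⟩, ?_⟩
      · rw [← hij]
        push_cast
        linarith [h1.2]
      · simp only [Prod.mk.injEq]
        zify
        rw [sq_abs, sq_abs]
        exact ⟨h1.2, by linarith⟩
    · rintro ⟨a, b⟩ hz
      obtain ⟨h1, h2⟩ := Finset.mem_filter.1 hz
      obtain ⟨⟨ha, hb⟩, h3⟩ := (mem_reps hm').1 h1
      simp only [Prod.mk.injEq] at h2 ha hb
      zify at h2
      rw [sq_abs, sq_abs] at h2
      refine Finset.mem_product.2 ⟨mem_sqrts.2 ⟨ha, h2.1⟩, (mem_reps hm').2 ⟨⟨rfl, hb⟩, ?_⟩⟩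
      simp only
      linarith [h2.2]
    · rintro ⟨a, x, b⟩ hz
      obtain ⟨h1, h2⟩ := Finset.mem_product.1 hz
      obtain ⟨⟨hx, hb⟩, h3⟩ := (mem_reps hm').1 h2
      simp only at hx
      simp [hx]
    · rintro ⟨a, b⟩ _; rfl
  · intro z hz
    obtain ⟨-, h⟩ := (mem_reps hm').1 hz
    refine mem_antidiagonal.2 ?_
    zify
    rw [sq_abs, sq_abs, h]

/-- Changing the sign of `y` (where `D` holds) or of `x` (where it fails) pairs off the
representations by `x ^ 2 + m * y ^ 2` with nonzero coordinates, so that modulo `2` only those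
on the axes count. -/
theorem card_reps_eq_of_flip {m : ℕ} (hm : m ≠ 0) (N : ℕ) (R D : ℤ → ℤ → Prop)
    (h1 : ∀ x y, R x y → D x y → R x (-y) ∧ D x (-y))
    (h2 : ∀ x y, R x y → ¬ D x y → R (-x) y ∧ ¬ D (-x) y)
    (h3 : ∀ y, R 0 y → ¬ D 0 y) (h4 : ∀ x, R x 0 → D x 0) :
    ((reps m N R).card : ZMod 2) =
      coeff N (theta (R · 0) + expand m hm (theta (R 0 ·))) := by
  classical
  have hm' := Nat.pos_of_ne_zero hm
  have e1 : coeff N (theta (R · 0)) = (((reps m N R).filter fun z => z.2 = 0).card : ZMod 2) := by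
    rw [coeff_theta]
    congr 1
    refine Finset.card_nbij' (fun x => (x, 0)) (fun z => z.1) ?_ ?_ ?_ ?_
    · intro x hx
      obtain ⟨ha, hb⟩ := mem_sqrts.1 hx
      exact Finset.mem_filter.2 ⟨(mem_reps hm').2 ⟨ha, by simpa using hb⟩, rfl⟩
    · rintro ⟨x, y⟩ hz
      obtain ⟨ha, hb⟩ := Finset.mem_filter.1 hz
      obtain ⟨hc, hd⟩ := (mem_reps hm').1 ha
      simp only at hb hc hd
      subst hb
      exact mem_sqrts.2 ⟨hc, by simpa using hd⟩
    · intro x _; rfl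
    · rintro ⟨x, y⟩ hz
      have := (Finset.mem_filter.1 hz).2
      simp only at this
      rw [this]
  have e2 : coeff N (expand m hm (theta (R 0 ·))) =
      (((reps m N R).filter fun z => z.1 = 0).card : ZMod 2) := by
    rw [coeff_expand_theta]
    congr 2
    ext ⟨x, y⟩
    rw [mem_reps hm', Finset.mem_filter, mem_reps hm']
    simp only
    constructor
    · rintro ⟨⟨rfl, h⟩, h'⟩; exact ⟨⟨h, h'⟩, rfl⟩
    · rintro ⟨⟨h, h'⟩, rfl⟩; exact ⟨⟨rfl, h⟩, h'⟩
  have e3 : (((reps m N R).filter fun z => ¬ (z.2 = 0 ∨ z.1 = 0)).card : ZMod 2) = 0 := by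
    refine card_eq_zero_of_involution _ (fun z => if D z.1 z.2 then (z.1, -z.2) else (-z.1, z.2))
      ?_ ?_ ?_
    · rintro ⟨x, y⟩ hz
      obtain ⟨ha, hb⟩ := Finset.mem_filter.1 hz
      obtain ⟨hc, hd⟩ := (mem_reps hm').1 ha
      simp only at hb hc hd ⊢
      refine Finset.mem_filter.2 ⟨(mem_reps hm').2 ?_, ?_⟩
      · split_ifs with h
        · exact ⟨(h1 x y hc h).1, by simpa using hd⟩
        · exact ⟨(h2 x y hc h).1, by simpa using hd⟩
      · split_ifs <;> simpa using hb
    · rintro ⟨x, y⟩ hz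
      obtain ⟨ha, hb⟩ := Finset.mem_filter.1 hz
      obtain ⟨hc, hd⟩ := (mem_reps hm').1 ha
      simp only at hb hc hd ⊢
      by_cases h : D x y
      · simp [h, (h1 x y hc h).2]
      · simp [h, (h2 x y hc h).2]
    · rintro ⟨x, y⟩ hz
      obtain ⟨ha, hb⟩ := Finset.mem_filter.1 hz
      simp only at hb ⊢
      split_ifs <;> simp only [ne_eq, Prod.mk.injEq, not_and] <;> omega
  have hdisj : Disjoint ((reps m N R).filter fun z => z.2 = 0)
      ((reps m N R).filter fun z => z.1 = 0) := by
    rw [Finset.disjoint_left]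
    rintro ⟨x, y⟩ hz hz'
    obtain ⟨ha, hb⟩ := Finset.mem_filter.1 hz
    have hx := (Finset.mem_filter.1 hz').2
    have hc := ((mem_reps hm').1 ha).1
    simp only at hb hx hc
    subst hb hx
    exact h3 0 hc (h4 0 hc)
  rw [map_add, e1, e2, ← Nat.cast_add, ← Finset.card_union_of_disjoint hdisj, ← Finset.filter_or,
    ← Finset.card_filter_add_card_filter_not (s := reps m N R) (fun z => z.2 = 0 ∨ z.1 = 0),
    Nat.cast_add, e3, add_zero]

/-- If `P` selects at most one integer from each pair `±a`, then `theta P` is the characteristic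
series of the squares of the selected integers. -/
theorem coeff_theta_eq {P : ℤ → Prop} {n : ℕ} (h : ∀ a : ℤ, P a → P (-a) → False)
    [Decidable (∃ a : ℤ, P a ∧ a ^ 2 = n)] :
    coeff n (theta P) = if ∃ a : ℤ, P a ∧ a ^ 2 = n then 1 else 0 := by
  rw [coeff_theta]
  split_ifs with h'
  · obtain ⟨a, ha⟩ := h'
    have : sqrts P n = {a} := by
      ext b
      rw [mem_sqrts, Finset.mem_singleton]
      constructor
      · rintro ⟨hb, hb'⟩
        rcases sq_eq_sq_iff_eq_or_eq_neg.1 (hb'.trans ha.2.symm) with h1 | h1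
        · exact h1
        · rw [h1] at hb; exact (h a ha.1 hb).elim
      · rintro rfl; exact ha
    rw [this, Finset.card_singleton, Nat.cast_one]
  · rw [Finset.card_eq_zero.2, Nat.cast_zero]
    exact Finset.eq_empty_of_forall_notMem fun a ha => h' ⟨a, mem_sqrts.1 ha⟩

/-- An odd square is the square of exactly one integer that is `1` modulo `4`. -/
theorem theta_four : theta (fun a => a % 4 = 1) = Delta := by
  classical
  ext n
  rw [coeff_theta_eq (fun a => by omega), coeff_Delta]
  refine if_congr ⟨?_, ?_⟩ rfl rfl
  · rintro ⟨a, ha, h⟩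
    refine ⟨(a.natAbs - 1) / 2, ?_⟩
    have : 2 * ((a.natAbs - 1) / 2) + 1 = a.natAbs := by omega
    rw [this]
    zify
    rw [sq_abs, h]
  · rintro ⟨m, rfl⟩
    rcases Nat.even_or_odd m with ⟨k, hk⟩ | ⟨k, hk⟩
    · exact ⟨2 * m + 1, by omega, by push_cast; ring⟩
    · exact ⟨-(2 * m + 1), by omega, by push_cast; ring⟩

/-- The odd squares prime to `3` and the odd squares divisible by `9` make up all odd squares. -/
theorem theta_six_add : theta (fun a => a % 6 = 1) + expand 9 (by norm_num) Delta = Delta := by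
  classical
  ext n
  rw [map_add, coeff_theta_eq (fun a => by omega), coeff_expand, ← theta_four, coeff_theta_eq
    (fun a => by omega), coeff_theta_eq (fun a => by omega), ← ite_and]
  have key : (9 ∣ n ∧ ∃ a : ℤ, a % 4 = 1 ∧ a ^ 2 = ((n / 9 : ℕ) : ℤ)) ↔
      ∃ a : ℤ, (a % 4 = 1 ∧ a % 3 = 0) ∧ a ^ 2 = n := by
    constructor
    · rintro ⟨⟨m, rfl⟩, a, ha, h⟩
      rw [Nat.mul_div_cancel_left _ (by norm_num)] at h
      exact ⟨-3 * a, ⟨by omega, by omega⟩, by push_cast; rw [← h]; ring⟩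
    · rintro ⟨a, ⟨ha, ha'⟩, h⟩
      obtain ⟨b, rfl⟩ := Int.dvd_of_emod_eq_zero ha'
      have h9 : 9 ∣ n := Int.natCast_dvd_natCast.1 ⟨b ^ 2, by rw [← h]; push_cast; ring⟩
      obtain ⟨m, rfl⟩ := h9
      refine ⟨dvd_mul_right _ _, -b, by omega, ?_⟩
      rw [Nat.mul_div_cancel_left _ (by norm_num)]
      push_cast at h
      linarith
  rw [if_congr key rfl rfl]
  by_cases h : ∃ a : ℤ, a % 4 = 1 ∧ a ^ 2 = (n : ℤ)
  · obtain ⟨a, ha, hn⟩ := h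
    rw [if_pos (⟨a, ha, hn⟩ : ∃ a : ℤ, a % 4 = 1 ∧ a ^ 2 = (n : ℤ))]
    by_cases h3 : a % 3 = 0
    · rw [if_pos (⟨a, ⟨ha, h3⟩, hn⟩ : ∃ a : ℤ, (a % 4 = 1 ∧ a % 3 = 0) ∧ a ^ 2 = (n : ℤ)),
        if_neg, zero_add]
      rintro ⟨b, hb, hb'⟩
      rcases sq_eq_sq_iff_eq_or_eq_neg.1 (hb'.trans hn.symm) with h1 | h1 <;> omega
    · rw [if_pos, if_neg, add_zero]
      · rintro ⟨b, ⟨hb, hb3⟩, hb'⟩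
        rcases sq_eq_sq_iff_eq_or_eq_neg.1 (hb'.trans hn.symm) with h1 | h1 <;> omega
      · by_cases h6 : a % 6 = 1
        · exact ⟨a, h6, hn⟩
        · have h2 : a % 6 = 5 := by
            have : a % 6 = 0 ∨ a % 6 = 1 ∨ a % 6 = 2 ∨ a % 6 = 3 ∨ a % 6 = 4 ∨ a % 6 = 5 := by
              omega
            omega
          exact ⟨-a, by omega, by rw [neg_sq, hn]⟩
  · rw [if_neg h, if_neg, if_neg, add_zero]
    · rintro ⟨a, ⟨ha, -⟩, h'⟩; exact h ⟨a, ha, h'⟩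
    · rintro ⟨a, ha, h'⟩
      by_cases h4 : a % 4 = 1
      · exact h ⟨a, h4, h'⟩
      · exact h ⟨-a, by omega, by rw [neg_sq, h']⟩

end

/-! ### The modular equations of levels `3` and `5` -/

section

open PowerSeries

theorem reps_three_eq_zero {N : ℕ} (hN : ¬ 4 ∣ N) :
    reps 3 N (fun x y => x % 4 = 1 ∧ y % 4 = 1) = ∅ := by
  refine Finset.eq_empty_of_forall_notMem fun z hz => hN ?_
  obtain ⟨⟨hx, hy⟩, h⟩ := (mem_reps three_pos).1 hz
  obtain ⟨a, ha⟩ : ∃ a, z.1 = 4 * a + 1 := ⟨z.1 / 4, by omega⟩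
  obtain ⟨b, hb⟩ : ∃ b, z.2 = 4 * b + 1 := ⟨z.2 / 4, by omega⟩
  refine Int.natCast_dvd_natCast.1 ⟨4 * a ^ 2 + 2 * a + 3 * (4 * b ^ 2 + 2 * b) + 1, ?_⟩
  rw [← h, ha, hb]; push_cast; ring

/-- The bijection is the division of `a + b √-3` by `1 + √-3`, an element of norm `4`. -/
theorem card_reps_three (M : ℕ) :
    (reps 3 (4 * M) (fun x y => x % 4 = 1 ∧ y % 4 = 1)).card =
      (reps 3 M (fun x y => (x + y) % 4 = 1)).card := by
  refine Finset.card_nbij' (fun z => ((z.1 + 3 * z.2) / 4, (z.2 - z.1) / 4))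
    (fun z => (z.1 - 3 * z.2, z.1 + z.2)) ?_ ?_ ?_ ?_
  · rintro ⟨a, b⟩ hz
    obtain ⟨⟨ha, hb⟩, h⟩ := (mem_reps three_pos).1 hz
    simp only at ha hb h
    obtain ⟨y, rfl⟩ : ∃ y, a = b - 4 * y := ⟨(b - a) / 4, by omega⟩
    have e1 : (b - 4 * y + 3 * b) / 4 = b - y := by omega
    have e2 : (b - (b - 4 * y)) / 4 = y := by omega
    refine (mem_reps three_pos).2 ?_
    simp only [e1, e2]
    refine ⟨by omega, ?_⟩
    push_cast at h ⊢
    linarith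
  · rintro ⟨x, y⟩ hz
    obtain ⟨ha, h⟩ := (mem_reps three_pos).1 hz
    simp only at ha h
    refine (mem_reps three_pos).2 ⟨⟨by simp only; omega, ha⟩, ?_⟩
    push_cast at h ⊢
    linarith
  · rintro ⟨a, b⟩ hz
    obtain ⟨⟨ha, hb⟩, h⟩ := (mem_reps three_pos).1 hz
    simp only at ha hb ⊢
    rw [Prod.mk.injEq]
    omega
  · rintro ⟨x, y⟩ hz
    simp only
    rw [Prod.mk.injEq]
    omega

/-- The modular equation of level `3` modulo `2`. The coefficient of `q ^ N` on the right counts the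
representations of `N` by `a ^ 2 + 3 * b ^ 2` with `a` and `b` congruent to `1` modulo `4`. If
`N = 4 * M`, dividing `a + b √-3` by `1 + √-3` turns them into representations of `M`; changes of
sign pair off all of these except those on the axes, which `Delta q + Delta (q ^ 3)` counts. -/
theorem modular_equation_three : (Delta + expand 3 three_ne_zero Delta) ^ 4 =
    Delta * expand 3 three_ne_zero Delta := by
  have hflip : ∀ M : ℕ, ((reps 3 M (fun x y => (x + y) % 4 = 1)).card : ZMod 2) =
      coeff M (Delta + expand 3 three_ne_zero Delta) := by
    intro M
    rw [card_reps_eq_of_flip three_ne_zero M _ (fun _ y => y % 2 = 0)]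
    · simp only [add_zero, zero_add, theta_four]
    all_goals intros; omega
  rw [show 4 = 2 * 2 by norm_num, pow_mul, sq_eq_expand, sq_eq_expand, ← expand_mul]
  ext N
  rw [coeff_expand]
  conv_rhs => rw [← theta_four, coeff_theta_mul_expand_theta]
  split_ifs with h
  · obtain ⟨M, rfl⟩ := h
    rw [Nat.mul_div_cancel_left _ (by norm_num), ← hflip, ← card_reps_three]
  · rw [reps_three_eq_zero h, Finset.card_empty, Nat.cast_zero]

theorem theta_six_eq :
    theta (fun a => a % 6 = 1) = Delta + expand 9 (by norm_num) Delta := by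
  have h := theta_six_add
  linear_combination h - expand 9 (by norm_num) Delta * two_eq_zero_powerSeries

theorem theta_six_ne_zero : theta (fun a => a % 6 = 1) ≠ 0 := by
  classical
  intro h
  have h1 : coeff 1 (theta (fun a => a % 6 = 1)) = 1 := by
    rw [coeff_theta_eq (fun a => by omega), if_pos ⟨1, by norm_num⟩]
  rw [h, map_zero] at h1
  exact zero_ne_one h1

/-- The cube of `∑ q ^ (a ^ 2)`, over the positive `a` prime to `6`, is `Delta (q ^ 3)`: the
sum of the modular equations of level `3` at `q` and at `q ^ 3` is this identity multiplied by the
theta series. -/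
theorem theta_six_cube : theta (fun a => a % 6 = 1) ^ 3 = expand 3 three_ne_zero Delta := by
  have h1 := modular_equation_three
  have h2 := congrArg (expand 3 three_ne_zero) h1
  rw [map_pow, map_add, map_mul, ← expand_mul] at h2
  have h9 : expand (3 * 3) (mul_ne_zero three_ne_zero three_ne_zero) Delta =
      expand 9 (by norm_num) Delta := rfl
  rw [h9] at h2
  refine mul_right_cancel₀ theta_six_ne_zero ?_
  rw [← pow_succ, theta_six_eq]
  set A := Delta
  set B := expand 9 (by norm_num) A
  set C := expand 3 three_ne_zero A
  have c2 := two_eq_zero_powerSeries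
  linear_combination h1 + h2 - (A ^ 3 * (2 * C - 2 * B) + 3 * A ^ 2 * (C ^ 2 - B ^ 2) +
    2 * A * (C ^ 3 - B ^ 3) + C ^ 4 + 2 * C ^ 3 * B + 3 * C ^ 2 * B ^ 2 + 2 * C * B ^ 3) * c2

theorem reps_five_eq_zero {N : ℕ} (hN : ¬ 6 ∣ N) :
    reps 5 N (fun x y => x % 6 = 1 ∧ y % 6 = 1) = ∅ := by
  refine Finset.eq_empty_of_forall_notMem fun z hz => hN ?_
  obtain ⟨⟨hx, hy⟩, h⟩ := (mem_reps (by norm_num)).1 hz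
  obtain ⟨a, ha⟩ : ∃ a, z.1 = 6 * a + 1 := ⟨z.1 / 6, by omega⟩
  obtain ⟨b, hb⟩ : ∃ b, z.2 = 6 * b + 1 := ⟨z.2 / 6, by omega⟩
  refine Int.natCast_dvd_natCast.1 ⟨6 * a ^ 2 + 2 * a + 5 * (6 * b ^ 2 + 2 * b) + 1, ?_⟩
  rw [← h, ha, hb]; push_cast; ring

/-- The bijection is the division of `a + b √-5` by `1 + √-5`, an element of norm `6`. -/
theorem card_reps_five (M : ℕ) :
    (reps 5 (6 * M) (fun x y => x % 6 = 1 ∧ y % 6 = 1)).card =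
      (reps 5 M (fun x y => (x + y) % 6 = 1)).card := by
  refine Finset.card_nbij' (fun z => ((z.1 + 5 * z.2) / 6, (z.2 - z.1) / 6))
    (fun z => (z.1 - 5 * z.2, z.1 + z.2)) ?_ ?_ ?_ ?_
  · rintro ⟨a, b⟩ hz
    obtain ⟨⟨ha, hb⟩, h⟩ := (mem_reps (by norm_num)).1 hz
    simp only at ha hb h
    obtain ⟨y, rfl⟩ : ∃ y, a = b - 6 * y := ⟨(b - a) / 6, by omega⟩
    have e1 : (b - 6 * y + 5 * b) / 6 = b - y := by omega
    have e2 : (b - (b - 6 * y)) / 6 = y := by omega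
    refine (mem_reps (by norm_num)).2 ?_
    simp only [e1, e2]
    refine ⟨by omega, ?_⟩
    push_cast at h ⊢
    linarith
  · rintro ⟨x, y⟩ hz
    obtain ⟨ha, h⟩ := (mem_reps (by norm_num)).1 hz
    simp only at ha h
    refine (mem_reps (by norm_num)).2 ⟨⟨by simp only; omega, ha⟩, ?_⟩
    push_cast at h ⊢
    linarith
  · rintro ⟨a, b⟩ hz
    obtain ⟨⟨ha, hb⟩, h⟩ := (mem_reps (by norm_num)).1 hz
    simp only at ha hb ⊢
    rw [Prod.mk.injEq]
    omega
  · rintro ⟨x, y⟩ hz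
    simp only
    rw [Prod.mk.injEq]
    omega

theorem emod_three_of_dvd {x y M : ℤ} (hxy : (x + y) % 6 = 1) (h : x ^ 2 + 5 * y ^ 2 = 3 * M) :
    x % 3 = 2 ∧ y % 3 = 2 := by
  have h3 : (3 : ℤ) ∣ (x + y) * (x - y) := ⟨M - 2 * y ^ 2, by linarith⟩
  rcases Int.prime_three.dvd_mul.1 h3 with h' | h' <;> omega

theorem nine_dvd_add_two_mul {x y M : ℤ} (hxy : (x + y) % 6 = 1)
    (h : x ^ 2 + 5 * y ^ 2 = 9 * M) : 9 ∣ x + 2 * y := by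
  have h2 := emod_three_of_dvd (M := 3 * M) hxy (by linarith)
  obtain ⟨l, rfl⟩ : ∃ l, x = y + 3 * l := ⟨(x - y) / 3, by omega⟩
  have h3 : 3 ∣ y * (y + l) :=
    (Int.prime_three.dvd_mul.1 (⟨M - l ^ 2, by linarith⟩ : (3 : ℤ) ∣ 2 * (y * (y + l)))
      ).resolve_left (by norm_num)
  rcases Int.prime_three.dvd_mul.1 h3 with h' | h' <;> omega

/-- The bijection is the division of `x + y √-5` by `2 - √-5`, an element of norm `9`. -/
theorem card_reps_five_nine_mul (M : ℕ) :
    (reps 5 (9 * M) (fun x y => (x + y) % 6 = 1)).card =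
      (reps 5 M (fun x y => (x + y) % 6 = 1)).card := by
  refine Finset.card_nbij' (fun z => ((2 * z.1 - 5 * z.2) / 9, (z.1 + 2 * z.2) / 9))
    (fun z => (2 * z.1 + 5 * z.2, 2 * z.2 - z.1)) ?_ ?_ ?_ ?_
  all_goals
    rintro ⟨x, y⟩ hz
    obtain ⟨ha, h⟩ := (mem_reps (by norm_num)).1 hz
    simp only at ha h
    push_cast at h
  · obtain ⟨k, hk⟩ := nine_dvd_add_two_mul ha h
    obtain rfl : x = 9 * k - 2 * y := by linarith
    have e1 : (2 * (9 * k - 2 * y) - 5 * y) / 9 = 2 * k - y := by omega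
    have e2 : (9 * k - 2 * y + 2 * y) / 9 = k := by omega
    refine (mem_reps (by norm_num)).2 ?_
    simp only [e1, e2]
    refine ⟨by omega, ?_⟩
    push_cast
    linarith
  · refine (mem_reps (by norm_num)).2 ⟨by simp only; omega, ?_⟩
    push_cast
    linarith
  · obtain ⟨k, hk⟩ := nine_dvd_add_two_mul ha h
    simp only
    rw [Prod.mk.injEq]
    omega
  · simp only
    rw [Prod.mk.injEq]
    omega

/-- When `3` divides the norm of `z = x + y √-5` exactly once, conjugating the cofactor of the
prime above `3` that divides `z` is an involution without fixed points. Explicitly, it sends `z` to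
`± (2 - √-5) / 3` times the conjugate of `z`, with the sign that preserves the congruence modulo
`6`. -/
theorem card_reps_five_three_mul {M : ℕ} (hM : ¬ 3 ∣ M) :
    ((reps 5 (3 * M) (fun x y => (x + y) % 6 = 1)).card : ZMod 2) = 0 := by
  refine card_eq_zero_of_involution _ (fun z =>
    if (z.1 - 7 * z.2) % 9 = 3 then ((2 * z.1 - 5 * z.2) / 3, -(z.1 + 2 * z.2) / 3)
    else (-(2 * z.1 - 5 * z.2) / 3, (z.1 + 2 * z.2) / 3)) ?_ ?_ ?_
  all_goals
    rintro ⟨x, y⟩ hz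
    obtain ⟨ha, h⟩ := (mem_reps (by norm_num)).1 hz
    simp only at ha h
    push_cast at h
    obtain ⟨h2, h2'⟩ := emod_three_of_dvd (M := M) ha (by linarith)
    obtain ⟨l, rfl⟩ : ∃ l, x = y + 3 * l := ⟨(x - y) / 3, by omega⟩
    have hl : (l + y) % 3 ≠ 0 := by
      intro h0
      obtain ⟨k, hk⟩ := Int.dvd_of_emod_eq_zero h0
      obtain rfl : l = 3 * k - y := by linarith
      refine hM (Int.natCast_dvd_natCast.1 ⟨y ^ 2 + 9 * k ^ 2 - 6 * k * y + 2 * y * k, ?_⟩)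
      push_cast
      linarith
    have e1 : (2 * (y + 3 * l) - 5 * y) / 3 = 2 * l - y := by omega
    have e2 : -(y + 3 * l + 2 * y) / 3 = -(l + y) := by omega
    have e3 : -(2 * (y + 3 * l) - 5 * y) / 3 = y - 2 * l := by omega
    have e4 : (y + 3 * l + 2 * y) / 3 = l + y := by omega
    simp only [e1, e2, e3, e4]
  · refine (mem_reps (by norm_num)).2 ?_
    split_ifs with hc
    · refine ⟨by simp only; omega, ?_⟩
      push_cast
      linarith
    · refine ⟨by simp only; omega, ?_⟩
      push_cast
      linarith
  · split_ifs <;> simp only [Prod.mk.injEq] at * <;> omega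
  · split_ifs <;> simp only [ne_eq, Prod.mk.injEq] <;> omega

theorem coeff_Delta_nine_mul (M : ℕ) : coeff (9 * M) Delta = coeff M Delta := by
  classical
  rw [coeff_Delta, coeff_Delta]
  refine if_congr ⟨?_, ?_⟩ rfl rfl
  · rintro ⟨m, hm⟩
    obtain ⟨c, hc⟩ : 3 ∣ 2 * m + 1 := Nat.prime_three.dvd_of_dvd_pow (n := 2) ⟨3 * M, by omega⟩
    obtain ⟨d, rfl⟩ : ∃ d, c = 2 * d + 1 := ⟨c / 2, by omega⟩
    refine ⟨d, ?_⟩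
    rw [hc] at hm
    nlinarith
  · rintro ⟨m, rfl⟩
    exact ⟨3 * m + 1, by ring⟩

theorem coeff_Delta_three_mul {M : ℕ} (hM : ¬ 3 ∣ M) : coeff (3 * M) Delta = 0 := by
  classical
  rw [coeff_Delta, if_neg]
  rintro ⟨m, hm⟩
  obtain ⟨c, hc⟩ : 3 ∣ 2 * m + 1 := Nat.prime_three.dvd_of_dvd_pow (n := 2) ⟨M, hm.symm⟩
  rw [hc] at hm
  exact hM ⟨c ^ 2, by nlinarith⟩

theorem coeff_theta_six {M : ℕ} (hM : ¬ 3 ∣ M) :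
    coeff M (theta (fun a => a % 6 = 1)) = coeff M Delta := by
  rw [theta_six_eq, map_add, coeff_expand, if_neg, add_zero]
  exact fun h => hM (dvd_trans (by norm_num) h)

/-- Exactly one of the coordinates is divisible by `3`, and its sign can be changed freely. -/
theorem card_reps_five_of_not_dvd {M : ℕ} (hM : ¬ 3 ∣ M) :
    ((reps 5 M (fun x y => (x + y) % 6 = 1)).card : ZMod 2) =
      coeff M (Delta + expand 5 (by norm_num) Delta) := by
  have hR : reps 5 M (fun x y => (x + y) % 6 = 1) =
      reps 5 M (fun x y => (x + y) % 6 = 1 ∧ (x % 3 = 0 ∨ y % 3 = 0)) := by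
    ext ⟨x, y⟩
    rw [mem_reps (by norm_num), mem_reps (by norm_num)]
    refine ⟨fun ⟨h1, h2⟩ => ⟨⟨h1, ?_⟩, h2⟩, fun ⟨h1, h2⟩ => ⟨h1.1, h2⟩⟩
    by_contra hxy
    push Not at hxy
    simp only at h1 h2 hxy
    have h3 : (3 : ℤ) ∣ x - y := by
      have hx : x % 3 = 1 ∨ x % 3 = 2 := by omega
      have hy : y % 3 = 1 ∨ y % 3 = 2 := by omega
      rcases hx with hx | hx <;> rcases hy with hy | hy <;> omega
    obtain ⟨l, hl⟩ := h3
    obtain rfl : x = y + 3 * l := by linarith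
    refine hM (Int.natCast_dvd_natCast.1 ⟨2 * y ^ 2 + 2 * y * l + 3 * l ^ 2, ?_⟩)
    push_cast at h2 ⊢
    linarith
  have e1 : (fun x : ℤ => (x + 0) % 6 = 1 ∧ (x % 3 = 0 ∨ (0 : ℤ) % 3 = 0)) =
      fun x => x % 6 = 1 := by
    funext x; simp
  have e2 : (fun y : ℤ => (0 + y) % 6 = 1 ∧ ((0 : ℤ) % 3 = 0 ∨ y % 3 = 0)) =
      fun y => y % 6 = 1 := by
    funext y; simp
  rw [hR, card_reps_eq_of_flip (by norm_num) M _ (fun _ y => y % 3 = 0), e1, e2, map_add, map_add,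
    coeff_theta_six hM, coeff_expand, coeff_expand]
  · congr 1
    split_ifs with h5
    · refine coeff_theta_six fun h => hM ?_
      obtain ⟨m, rfl⟩ := h5
      rw [Nat.mul_div_cancel_left _ (by norm_num)] at h
      exact h.mul_left 5
    · rfl
  all_goals intros; omega

/-- Modulo `2` only representations on the axes count, up to a descent that divides `M` by `9`. -/
theorem card_reps_five_eq (M : ℕ) : ((reps 5 M (fun x y => (x + y) % 6 = 1)).card : ZMod 2) =
    coeff M (Delta + expand 5 (by norm_num) Delta) := by
  induction M using Nat.strong_induction_on with
  | _ M ih =>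
    rcases Nat.eq_zero_or_pos M with rfl | hM0
    · have h0 : reps 5 0 (fun x y => (x + y) % 6 = 1) = ∅ := by
        refine Finset.eq_empty_of_forall_notMem fun z hz => ?_
        obtain ⟨h1, h2⟩ := (mem_reps (by norm_num)).1 hz
        push_cast at h2
        have hx : z.1 = 0 := by nlinarith
        have hy : z.2 = 0 := by nlinarith
        omega
      rw [h0, Finset.card_empty, Nat.cast_zero, map_add, coeff_zero_eq_constantCoeff,
        constantCoeff_expand, CharTwo.add_self_eq_zero]
    by_cases h3 : 3 ∣ M
    · obtain ⟨K, rfl⟩ := h3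
      by_cases h9 : 3 ∣ K
      · obtain ⟨L, rfl⟩ := h9
        rw [← mul_assoc, show 3 * 3 = 9 by norm_num, card_reps_five_nine_mul,
          ih L (by omega), map_add, map_add, coeff_Delta_nine_mul, coeff_expand, coeff_expand]
        simp only [(by norm_num : Nat.Coprime 5 9).dvd_mul_left]
        congr 1
        split_ifs with h5
        · obtain ⟨m, rfl⟩ := h5
          rw [mul_left_comm, Nat.mul_div_cancel_left _ (by norm_num),
            Nat.mul_div_cancel_left _ (by norm_num), coeff_Delta_nine_mul]
        · rfl
      · rw [card_reps_five_three_mul h9, map_add, coeff_Delta_three_mul h9, coeff_expand]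
        simp only [(by norm_num : Nat.Coprime 5 3).dvd_mul_left]
        split_ifs with h5
        · obtain ⟨m, rfl⟩ := h5
          rw [mul_left_comm, Nat.mul_div_cancel_left _ (by norm_num), coeff_Delta_three_mul,
            add_zero]
          exact fun h => h9 (h.mul_left 5)
        · rw [add_zero]
    · exact card_reps_five_of_not_dvd h3

/-- The modular equation of level `5` modulo `2`. With `G` the theta series over the positive
integers prime to `6`, counting representations by `a ^ 2 + 5 * b ^ 2` gives
`G(q) * G(q ^ 5) = Delta (q ^ 6) + Delta (q ^ 30)`; the cube of this identity is the modular equation in the variable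
`q ^ 3`, because `G ^ 3 = Delta (q ^ 3)`. -/
theorem modular_equation_five : (Delta + expand 5 (by norm_num) Delta) ^ 6 =
    Delta * expand 5 (by norm_num) Delta := by
  set W := Delta + expand 5 (by norm_num) Delta with hW
  set G := theta (fun a => a % 6 = 1) with hG
  have h1 : G * expand 5 (by norm_num) G = expand 6 (by norm_num) W := by
    ext N
    rw [coeff_theta_mul_expand_theta, coeff_expand]
    split_ifs with h
    · obtain ⟨M, rfl⟩ := h
      rw [Nat.mul_div_cancel_left _ (by norm_num), card_reps_five, card_reps_five_eq]
    · rw [reps_five_eq_zero h, Finset.card_empty, Nat.cast_zero]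
  have h2 := congrArg (· ^ 3) h1
  simp only [mul_pow] at h2
  rw [← map_pow, hG, theta_six_cube, ← map_pow, ← expand_mul] at h2
  have hinj : Function.Injective (expand 3 three_ne_zero : (ZMod 2)⟦X⟧ → (ZMod 2)⟦X⟧) := by
    intro f g hfg
    ext n
    rw [← coeff_expand_mul 3 three_ne_zero f, hfg, coeff_expand_mul]
  refine hinj ?_
  rw [map_mul, ← expand_mul]
  refine Eq.trans ?_ h2.symm
  have h3 : W ^ 6 = expand 2 two_ne_zero (W ^ 3) := by rw [← sq_eq_expand, ← pow_mul]
  rw [h3, ← expand_mul]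

end

/-! ### Recurrences for `T₃` and `T₅` -/

section

open PowerSeries

/-- A polynomial relation between `Delta q` and `Delta (q ^ p)`, together with its mirror image,
gives a recurrence for the images of the powers of `Delta` under `T_p`. A pair `(a, b)` in the list
stands for the monomial `X ^ a * Y ^ b` in `X = Delta q` and `Y = Delta (q ^ p)`. -/
theorem hecke_pow_add_of_relation {p : ℕ} (hp : p ≠ 0) (N : ℕ) (l : List (ℕ × ℕ))
    (h1 : Delta ^ N = (l.map fun x => Delta ^ x.1 * expand p hp Delta ^ x.2).sum)
    (h2 : expand p hp Delta ^ N = (l.map fun x => expand p hp Delta ^ x.1 * Delta ^ x.2).sum)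
    (j : ℕ) :
    hecke p (Delta ^ (j + N)) =
      (l.map fun x => Delta ^ x.2 * hecke p (Delta ^ (j + x.1))).sum := by
  have hU : heckeU p (Delta ^ (j + N)) =
      (l.map fun x => Delta ^ x.2 * heckeU p (Delta ^ (j + x.1))).sum := by
    rw [pow_add, h1, ← List.sum_map_mul_left, map_list_sum, List.map_map]
    congr 1
    refine List.map_congr_left fun x _ => ?_
    rw [← heckeU_expand_mul hp, map_pow]
    simp only [Function.comp]
    congr 1
    ring
  have hV : expand p hp (Delta ^ (j + N)) =
      (l.map fun x => Delta ^ x.2 * expand p hp (Delta ^ (j + x.1))).sum := by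
    rw [map_pow, pow_add, h2, ← List.sum_map_mul_left]
    congr 1
    refine List.map_congr_left fun x _ => ?_
    rw [map_pow]
    ring
  rw [hecke_eq hp, hU, hV, ← List.sum_map_add]
  congr 1
  refine List.map_congr_left fun x _ => ?_
  rw [hecke_eq hp, mul_add]

/-- The `2 ^ s`-th power of `(x + y) ^ 4 = x * y`, solved for `x ^ (4 * 2 ^ s)`. The factor `x ^ 0`
is written out to match the shape used in `hecke_pow_add_of_relation`. -/
theorem pow_four_relation {x y : (ZMod 2)⟦X⟧} (h : (x + y) ^ 4 = x * y) (s : ℕ) :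
    x ^ (4 * 2 ^ s) = x ^ 2 ^ s * y ^ 2 ^ s + x ^ 0 * y ^ (4 * 2 ^ s) := by
  have h1 : x ^ 4 = x * y + y ^ 4 := by
    linear_combination h - (2 * x ^ 3 * y + 3 * x ^ 2 * y ^ 2 + 2 * x * y ^ 3 + y ^ 4) *
      two_eq_zero_powerSeries
  rw [pow_mul, h1, add_pow_char_pow, mul_pow, ← pow_mul]
  ring

/-- The equation `(x + y) ^ 6 = x * y`, expanded in characteristic `2` and solved for `x ^ 6`. -/
theorem pow_six_relation {x y : (ZMod 2)⟦X⟧} (h : (x + y) ^ 6 = x * y) :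
    x ^ 6 = x ^ 4 * y ^ 2 + x ^ 2 * y ^ 4 + x * y + y ^ 6 := by
  linear_combination h - (3 * x ^ 5 * y + 8 * x ^ 4 * y ^ 2 + 10 * x ^ 3 * y ^ 3 +
    8 * x ^ 2 * y ^ 4 + 3 * x * y ^ 5 + y ^ 6) * two_eq_zero_powerSeries

/-- If `(x + y) ^ 6 = x * y`, then
`(x + y) ^ 16 = (x * y) ^ 2 * (x + y) ^ 4 = x ^ 6 * y ^ 2 + x ^ 2 * y ^ 6`,
where `x ^ 6` can be eliminated; the result is raised to the power `2 ^ s`. The terms `y ^ 16` and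
`x ^ 4 * y ^ 4` play the role of the terms `y ^ 4` and `x * y` in level `3`. -/
theorem pow_sixteen_relation {x y : (ZMod 2)⟦X⟧} (h : (x + y) ^ 6 = x * y) (s : ℕ) :
    x ^ (16 * 2 ^ s) = x ^ 0 * y ^ (16 * 2 ^ s) + x ^ (4 * 2 ^ s) * y ^ (4 * 2 ^ s) +
      x ^ 0 * y ^ (8 * 2 ^ s) + x ^ 2 ^ s * y ^ (3 * 2 ^ s) := by
  have h6 := pow_six_relation h
  have h12 : x ^ 12 = x ^ 8 * y ^ 4 + x ^ 4 * y ^ 8 + x ^ 2 * y ^ 2 + y ^ 12 := by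
    have := congrArg (· ^ 2) h6
    simp only [CharTwo.add_sq, mul_pow, ← pow_mul] at this
    exact this
  have h16 : x ^ 16 = y ^ 16 + x ^ 4 * y ^ 4 + y ^ 8 + x * y ^ 3 := by
    linear_combination (x ^ 4 + y ^ 4) * h12 + y ^ 2 * h6 +
      (x ^ 8 * y ^ 8 + x ^ 4 * y ^ 12 + x ^ 2 * y ^ 6) * two_eq_zero_powerSeries
  rw [pow_mul, h16, add_pow_char_pow, add_pow_char_pow, add_pow_char_pow, mul_pow, mul_pow]
  ring

theorem modular_equation_three' : (expand 3 three_ne_zero Delta + Delta) ^ 4 =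
    expand 3 three_ne_zero Delta * Delta := by
  rw [add_comm, modular_equation_three, mul_comm]

theorem modular_equation_five' : (expand 5 (by norm_num) Delta + Delta) ^ 6 =
    expand 5 (by norm_num) Delta * Delta := by
  rw [add_comm, modular_equation_five, mul_comm]

theorem hecke_three_pow_add (s j : ℕ) : hecke 3 (Delta ^ (j + 4 * 2 ^ s)) =
    Delta ^ 2 ^ s * hecke 3 (Delta ^ (j + 2 ^ s)) + Delta ^ (4 * 2 ^ s) * hecke 3 (Delta ^ j) := by
  have h := hecke_pow_add_of_relation three_ne_zero (4 * 2 ^ s) [(2 ^ s, 2 ^ s), (0, 4 * 2 ^ s)]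
    (by simpa using pow_four_relation modular_equation_three s)
    (by simpa using pow_four_relation modular_equation_three' s) j
  simpa using h

theorem hecke_five_pow_add_six (j : ℕ) : hecke 5 (Delta ^ (j + 6)) =
    Delta ^ 2 * hecke 5 (Delta ^ (j + 4)) + Delta ^ 4 * hecke 5 (Delta ^ (j + 2)) +
      Delta * hecke 5 (Delta ^ (j + 1)) + Delta ^ 6 * hecke 5 (Delta ^ j) := by
  have h := hecke_pow_add_of_relation (p := 5) (by norm_num) 6 [(4, 2), (2, 4), (1, 1), (0, 6)]
    (by simpa [add_assoc] using pow_six_relation modular_equation_five)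
    (by simpa [add_assoc] using pow_six_relation modular_equation_five') j
  simpa [add_assoc] using h

theorem hecke_five_pow_add (s j : ℕ) : hecke 5 (Delta ^ (j + 16 * 2 ^ s)) =
    Delta ^ (16 * 2 ^ s) * hecke 5 (Delta ^ j) +
      Delta ^ (4 * 2 ^ s) * hecke 5 (Delta ^ (j + 4 * 2 ^ s)) +
      Delta ^ (8 * 2 ^ s) * hecke 5 (Delta ^ j) +
      Delta ^ (3 * 2 ^ s) * hecke 5 (Delta ^ (j + 2 ^ s)) := by
  have h := hecke_pow_add_of_relation (p := 5) (by norm_num) (16 * 2 ^ s)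
    [(0, 16 * 2 ^ s), (4 * 2 ^ s, 4 * 2 ^ s), (0, 8 * 2 ^ s), (2 ^ s, 3 * 2 ^ s)]
    (by simpa [add_assoc] using pow_sixteen_relation modular_equation_five s)
    (by simpa [add_assoc] using pow_sixteen_relation modular_equation_five' s) j
  simpa [add_assoc] using h

theorem hecke_Delta_pow_two_mul {p : ℕ} (hp : Odd p) (k : ℕ) :
    hecke p (Delta ^ (2 * k)) = hecke p (Delta ^ k) ^ 2 := by
  rw [mul_comm, pow_mul, hecke_sq hp]

theorem eq_of_sq_eq_mul {w x : (ZMod 2)⟦X⟧} (h : w ^ 2 = x * w) (hw : coeff 1 w = 1) : w = x := by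
  have hw0 : w ≠ 0 := by
    rintro rfl
    simp at hw
  exact mul_right_cancel₀ hw0 (by rw [← sq, h])

theorem coeff_one_hecke {p : ℕ} (hp : p.Prime) :
    coeff 1 (hecke p (Delta ^ p)) = 1 := by
  rw [coeff_hecke, mul_one, (coeff_Delta_pow_self p).1, if_neg, add_zero]
  exact hp.one_lt.not_ge ∘ Nat.le_of_dvd one_pos

/-- The square of `T₃ Δ³` is `T₃ Δ⁶ = Δ * T₃ Δ³` by the recurrence. -/
theorem hecke_three_pow_three : hecke 3 (Delta ^ 3) = Delta := by
  refine eq_of_sq_eq_mul ?_ (coeff_one_hecke Nat.prime_three)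
  rw [← hecke_Delta_pow_two_mul (by decide)]
  have h := hecke_three_pow_add 0 2
  have h2 : hecke 3 (Delta ^ (2 * 1)) = 0 := by
    rw [hecke_Delta_pow_two_mul (by decide), pow_one, hecke_Delta Nat.prime_three (by decide)]
    simp
  norm_num at h h2 ⊢
  rw [h, h2, mul_zero, add_zero]

/-- The square of `T₅ Δ³` is `T₅ Δ⁶ = 0` by the recurrence. -/
theorem hecke_five_pow_three : hecke 5 (Delta ^ 3) = 0 := by
  have hodd : Odd 5 := by decide
  have h1 : hecke 5 Delta = 0 := hecke_Delta Nat.prime_five hodd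
  have h2 : hecke 5 (Delta ^ (2 * 1)) = 0 := by
    rw [hecke_Delta_pow_two_mul hodd, pow_one, h1]; simp
  have h4 : hecke 5 (Delta ^ (2 * 2)) = 0 := by
    rw [hecke_Delta_pow_two_mul hodd 2, h2]; simp
  have h := hecke_five_pow_add_six 0
  have h6 := hecke_Delta_pow_two_mul hodd 3
  norm_num [h1, hecke_one] at h h2 h4 h6
  rw [h, h2, h4] at h6
  simpa using h6.symm

/-- The square of `T₅ Δ⁵` is `T₅ Δ¹⁰ = Δ * T₅ Δ⁵` by the recurrence. -/
theorem hecke_five_pow_five : hecke 5 (Delta ^ 5) = Delta := by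
  have hodd : Odd 5 := by decide
  refine eq_of_sq_eq_mul ?_ (coeff_one_hecke Nat.prime_five)
  have h1 : hecke 5 Delta = 0 := hecke_Delta Nat.prime_five hodd
  have h2 : hecke 5 (Delta ^ (2 * 1)) = 0 := by
    rw [hecke_Delta_pow_two_mul hodd, pow_one, h1]; simp
  have h4 : hecke 5 (Delta ^ (2 * 2)) = 0 := by
    rw [hecke_Delta_pow_two_mul hodd 2, h2]; simp
  have h8 : hecke 5 (Delta ^ (2 * 4)) = 0 := by
    rw [hecke_Delta_pow_two_mul hodd 4, h4]; simp
  have h6 : hecke 5 (Delta ^ (2 * 3)) = 0 := by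
    rw [hecke_Delta_pow_two_mul hodd 3, hecke_five_pow_three]; simp
  rw [← hecke_Delta_pow_two_mul hodd]
  have h := hecke_five_pow_add_six 4
  norm_num at h h4 h6 h8 ⊢
  rw [h, h4, h6, h8]
  ring

end

/-! ### Codes and binary addition -/

/-- Removing the two lowest binary digits. -/
theorem n₃_eq_sum_range {k N : ℕ} (hkN : k ≤ N) :
    n₃ k = ∑ i ∈ Finset.range N, (k.testBit (2 * i + 1)).toNat * 2 ^ i := by
  refine Finset.sum_subset (Finset.range_subset_range.2 hkN) fun i _ hi => ?_
  have hi : k ≤ i := by simpa using hi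
  rw [Nat.testBit_lt_two_pow (Nat.lt_two_pow_self.trans_le
    (Nat.pow_le_pow_right two_pos (by omega)))]
  simp

theorem n₃_eq (k : ℕ) : n₃ k = k / 2 % 2 + 2 * n₃ (k / 4) := by
  rw [n₃_eq_sum_range (Nat.le_succ k), n₃_eq_sum_range (Nat.div_le_self k 4),
    Finset.sum_range_succ', Finset.mul_sum, add_comm]
  congr 1
  · simp [Nat.testBit_succ, Nat.testBit_zero]
    rcases Nat.mod_two_eq_zero_or_one (k / 2) with h | h <;> simp [h]
  · refine Finset.sum_congr rfl fun i _ => ?_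
    rw [show 2 * (i + 1) + 1 = 2 * i + 1 + 1 + 1 by ring, Nat.testBit_succ, Nat.testBit_succ,
      Nat.div_div_eq_div_mul]
    ring

theorem n₅_eq (k : ℕ) : n₅ k = n₃ (k / 2) := by
  rw [n₃_eq_sum_range (Nat.div_le_self k 2)]
  exact Finset.sum_congr rfl fun i _ => by rw [Nat.testBit_succ]

theorem n₃_zero : n₃ 0 = 0 := rfl

theorem n₃_one : n₃ 1 = 0 := by rw [n₃_eq]; rfl

theorem n₃_two_pow_even (i : ℕ) : n₃ (2 ^ (2 * i)) = 0 := by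
  induction i with
  | zero => exact n₃_one
  | succ i ih =>
    rw [n₃_eq, show 2 ^ (2 * (i + 1)) = 4 * 2 ^ (2 * i) by ring, Nat.mul_div_cancel_left _ four_pos,
      ih]
    omega

theorem n₃_two_pow_odd (i : ℕ) : n₃ (2 ^ (2 * i + 1)) = 2 ^ i := by
  induction i with
  | zero => rw [n₃_eq]; rfl
  | succ i ih =>
    rw [n₃_eq, show 2 ^ (2 * (i + 1) + 1) = 4 * 2 ^ (2 * i + 1) by ring,
      Nat.mul_div_cancel_left _ four_pos, ih, pow_succ 2 i]
    omega

theorem n₅_two_pow_odd (i : ℕ) : n₅ (2 ^ (2 * i + 1)) = 0 := by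
  rw [n₅_eq, pow_succ, Nat.mul_div_cancel _ two_pos, n₃_two_pow_even]

theorem n₅_two_pow_even (i : ℕ) : n₅ (2 ^ (2 * i + 2)) = 2 ^ i := by
  rw [n₅_eq, pow_succ, Nat.mul_div_cancel _ two_pos, n₃_two_pow_odd]

theorem n₃_add_two_pow {k p : ℕ} (hk : k.testBit p = false) :
    n₃ (k + 2 ^ p) = n₃ k + n₃ (2 ^ p) := by
  induction p using Nat.twoStepInduction generalizing k with
  | zero =>
    have h0 : k % 2 = 0 := by simpa [Nat.testBit_zero] using hk
    rw [pow_zero, n₃_one, n₃_eq (k + 1), n₃_eq k, show (k + 1) / 2 = k / 2 by omega,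
      show (k + 1) / 4 = k / 4 by omega, add_zero]
  | one =>
    have h0 : k / 2 % 2 = 0 := by simpa [Nat.testBit_succ, Nat.testBit_zero] using hk
    have h1 : n₃ 2 = 1 := n₃_two_pow_odd 0
    rw [pow_one, h1, n₃_eq (k + 2), n₃_eq k, show (k + 2) / 4 = k / 4 by omega]
    omega
  | more p ih _ =>
    rw [Nat.testBit_succ, Nat.testBit_succ, Nat.div_div_eq_div_mul] at hk
    have h0 : n₃ (k / (2 * 2)) = n₃ (k / 4) := rfl
    have h4 : 2 ^ (p + 2) = 4 * 2 ^ p := by ring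
    rw [n₃_eq (k + 2 ^ (p + 2)), n₃_eq k, n₃_eq (2 ^ (p + 2)), h4,
      show (k + 4 * 2 ^ p) / 4 = k / 4 + 2 ^ p by omega, ih hk,
      Nat.mul_div_cancel_left _ four_pos, h0]
    omega

theorem n₅_add_two_pow {k p : ℕ} (hk : k.testBit p = false) :
    n₅ (k + 2 ^ p) = n₅ k + n₅ (2 ^ p) := by
  cases p with
  | zero =>
    have h0 : k % 2 = 0 := by simpa [Nat.testBit_zero] using hk
    rw [n₅_eq, n₅_eq, n₅_eq, pow_zero, show (k + 1) / 2 = k / 2 by omega]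
    rfl
  | succ p =>
    rw [Nat.testBit_succ] at hk
    rw [n₅_eq, n₅_eq, n₅_eq, pow_succ, show (k + 2 ^ p * 2) / 2 = k / 2 + 2 ^ p by omega,
      Nat.mul_div_cancel _ two_pos, n₃_add_two_pow hk]

/-- An integer is determined by its code and its parity. -/
theorem eq_of_code_eq {k l : ℕ} (h0 : k % 2 = l % 2) (h3 : n₃ k = n₃ l) (h5 : n₅ k = n₅ l) :
    k = l := by
  induction hN : k + l using Nat.strong_induction_on generalizing k l with
  | _ N ih =>
    rcases Nat.eq_zero_or_pos N with rfl | hpos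
    · omega
    · rw [n₃_eq k, n₃_eq l] at h3
      rw [n₅_eq, n₅_eq, n₃_eq (k / 2), n₃_eq (l / 2), Nat.div_right_comm k 2 4,
        Nat.div_right_comm l 2 4,
        ← n₅_eq, ← n₅_eq] at h5
      have := ih (k / 4 + l / 4) (by omega) (k := k / 4) (l := l / 4) (by omega) (by omega)
        (by omega) rfl
      omega

theorem exists_eq_add_two_pow_of_testBit {k p : ℕ} (hk : k.testBit p = true) :
    ∃ l, l.testBit p = false ∧ k = l + 2 ^ p := by
  have h1 : k = (k - 2 ^ p) + 2 ^ p := (Nat.sub_add_cancel (Nat.ge_two_pow_of_testBit hk)).symm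
  refine ⟨k - 2 ^ p, ?_, h1⟩
  rw [h1, add_comm, Nat.testBit_two_pow_add_eq] at hk
  simpa using hk

/-- The codes of the powers of `2`: `[2 ^ i, 0]` at odd exponents, `[0, 2 ^ i]` at even ones. -/
theorem code_two_pow (p : ℕ) (hp : p ≠ 0) : ∃ i,
    (p = 2 * i + 1 ∧ n₃ (2 ^ p) = 2 ^ i ∧ n₅ (2 ^ p) = 0) ∨
    (p = 2 * i + 2 ∧ n₃ (2 ^ p) = 0 ∧ n₅ (2 ^ p) = 2 ^ i) := by
  obtain ⟨i, rfl | rfl⟩ := Nat.even_or_odd' p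
  · obtain ⟨i, rfl⟩ := Nat.exists_eq_succ_of_ne_zero (n := i) (by omega)
    exact ⟨i, .inr ⟨by omega, n₃_two_pow_even _, n₅_two_pow_even _⟩⟩
  · exact ⟨i, .inl ⟨rfl, n₃_two_pow_odd _, n₅_two_pow_odd _⟩⟩

theorem n₃_lt_of_testBit {k i : ℕ} (hk : k < 2 ^ (2 * i + 3)) (hb : k.testBit (2 * i + 1) = false) :
    n₃ k < 2 ^ i := by
  induction i generalizing k with
  | zero =>
    have h0 : k / 2 % 2 = 0 := by simpa [Nat.testBit_succ, Nat.testBit_zero] using hb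
    have h1 : k / 4 = 0 ∨ k / 4 = 1 := by omega
    rw [n₃_eq, h0]
    rcases h1 with h1 | h1 <;> simp [h1, n₃_one, n₃_zero]
  | succ i ih =>
    rw [show 2 * (i + 1) + 1 = 2 * i + 1 + 1 + 1 by ring, Nat.testBit_succ, Nat.testBit_succ,
      Nat.div_div_eq_div_mul] at hb
    have h4 : 2 ^ (2 * (i + 1) + 3) = 4 * 2 ^ (2 * i + 3) := by ring
    have := ih (k := k / 4) (by omega) hb
    have h5 : 2 ^ (i + 1) = 2 * 2 ^ i := by ring
    rw [n₃_eq]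
    omega

theorem n₅_lt_of_testBit {k i : ℕ} (hk : k < 2 ^ (2 * i + 4)) (hb : k.testBit (2 * i + 2) = false) :
    n₅ k < 2 ^ i := by
  have h4 : 2 ^ (2 * i + 4) = 2 * 2 ^ (2 * i + 3) := by ring
  rw [n₅_eq]
  rw [Nat.testBit_succ] at hb
  exact n₃_lt_of_testBit (by omega) hb

/-- Adding a power `2 ^ p` with `p ≠ 0` increases the pair `(h, n₅)` at most by that of `2 ^ p`, in
the lexicographic order, and by strictly less when a carry occurs: a carry replaces `2 ^ p + 2 ^ p`
by `2 ^ (p + 1)`, whose pair is less than twice that of `2 ^ p`. -/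
theorem ord_add_two_pow {p : ℕ} (hp : p ≠ 0) (k : ℕ) :
    n₃ (k + 2 ^ p) + n₅ (k + 2 ^ p) < n₃ k + n₅ k + (n₃ (2 ^ p) + n₅ (2 ^ p)) ∨
    (n₃ (k + 2 ^ p) + n₅ (k + 2 ^ p) = n₃ k + n₅ k + (n₃ (2 ^ p) + n₅ (2 ^ p)) ∧
      (n₅ (k + 2 ^ p) < n₅ k + n₅ (2 ^ p) ∨
        (k.testBit p = false ∧ n₅ (k + 2 ^ p) = n₅ k + n₅ (2 ^ p)))) := by
  induction k using Nat.strong_induction_on generalizing p with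
  | _ k ih =>
    cases hb : k.testBit p with
    | false => simp [n₃_add_two_pow hb, n₅_add_two_pow hb]; omega
    | true =>
      obtain ⟨l, hl, rfl⟩ := exists_eq_add_two_pow_of_testBit hb
      have h1 := ih l (Nat.lt_add_of_pos_right (by positivity)) (Nat.succ_ne_zero p)
      rw [show l + 2 ^ p + 2 ^ p = l + 2 ^ (p + 1) by ring, n₃_add_two_pow hl, n₅_add_two_pow hl]
      have h0 := @Nat.two_pow_pos
      obtain ⟨i, ⟨rfl, h3, h5⟩ | ⟨rfl, h3, h5⟩⟩ := code_two_pow p hp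
      · have h3' : n₃ (2 ^ (2 * i + 1 + 1)) = 0 := n₃_two_pow_even (i + 1)
        have h5' : n₅ (2 ^ (2 * i + 1 + 1)) = 2 ^ i := n₅_two_pow_even i
        have := h0 i
        simp only [Nat.succ_eq_add_one] at h1
        omega
      · have h3' : n₃ (2 ^ (2 * i + 2 + 1)) = 2 ^ (i + 1) := n₃_two_pow_odd (i + 1)
        have h5' : n₅ (2 ^ (2 * i + 2 + 1)) = 0 := n₅_two_pow_odd (i + 1)
        have := h0 i
        have : 2 ^ (i + 1) = 2 * 2 ^ i := by ring
        simp only [Nat.succ_eq_add_one] at h1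
        omega

/-! ### Operators that lower the code -/

/-- The space spanned by the powers `Delta ^ e` with `e ∈ S`. -/
noncomputable def powSpan (S : Set ℕ) : Submodule (ZMod 2) (ZMod 2)⟦X⟧ :=
  Submodule.span (ZMod 2) ((fun e => Delta ^ e) '' S)

theorem Delta_pow_mem_powSpan {S : Set ℕ} {e : ℕ} (he : e ∈ S) : Delta ^ e ∈ powSpan S :=
  Submodule.subset_span ⟨e, he, rfl⟩

theorem powSpan_mono {S T : Set ℕ} (h : S ⊆ T) : powSpan S ≤ powSpan T :=
  Submodule.span_mono (Set.image_mono h)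

theorem powSpan_le {S : Set ℕ} {W : Submodule (ZMod 2) (ZMod 2)⟦X⟧}
    (h : ∀ e ∈ S, Delta ^ e ∈ W) : powSpan S ≤ W := by
  refine Submodule.span_le.2 ?_
  rintro _ ⟨e, he, rfl⟩
  exact h e he

theorem Delta_pow_mul_mem_powSpan {S T : Set ℕ} {f : (ZMod 2)⟦X⟧} (a : ℕ) (hf : f ∈ powSpan S)
    (h : ∀ e ∈ S, e + a ∈ T) : Delta ^ a * f ∈ powSpan T := by
  have : powSpan S ≤ (powSpan T).comap (LinearMap.mulLeft (ZMod 2) (Delta ^ a)) := by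
    refine powSpan_le fun e he => ?_
    rw [Submodule.mem_comap, LinearMap.mulLeft_apply, ← pow_add, add_comm]
    exact Delta_pow_mem_powSpan (h e he)
  exact this hf

/-- The odd exponents `e` for which `(h e, n₅ e) + (1, d)` is at most `(h k, n₅ k)`
in the lexicographic order. -/
def lowerEq (d k : ℕ) : Set ℕ :=
  {e | Odd e ∧ (n₃ e + n₅ e + 1 < n₃ k + n₅ k ∨
    (n₃ e + n₅ e + 1 = n₃ k + n₅ k ∧ n₅ e + d ≤ n₅ k))}

/-- The odd exponents `e` for which `(h e, n₅ e) + (1, d)` is less than `(h k, n₅ k)`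
in the lexicographic order. -/
def lower (d k : ℕ) : Set ℕ :=
  {e | Odd e ∧ (n₃ e + n₅ e + 1 < n₃ k + n₅ k ∨
    (n₃ e + n₅ e + 1 = n₃ k + n₅ k ∧ n₅ e + d < n₅ k))}

theorem lower_subset_lowerEq (d k : ℕ) : lower d k ⊆ lowerEq d k := fun _ he =>
  ⟨he.1, he.2.imp_right fun h => ⟨h.1, h.2.le⟩⟩

/-- The operator `T` lowers the code of `k` by `[1, 0]` if `d = 0` and by `[0, 1]` if `d = 1`:
the image of `Delta ^ k` is `Delta ^ m`, where `m` has the lowered code, up to powers with smaller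
exponents; there is no term `Delta ^ m` if the code of `k` cannot be lowered.

For `d ≤ 1` the condition `d ≤ n₅ k ∧ 1 ≤ n₃ k + d` says that the component of the code of `k` to be
lowered is nonzero. In terms of `(h, n₅)` the code is lowered by `(1, d)`. -/
structure LowersCode (T : Module.End (ZMod 2) (ZMod 2)⟦X⟧) (d k : ℕ) : Prop where
  mem : ¬ (d ≤ n₅ k ∧ 1 ≤ n₃ k + d) → T (Delta ^ k) ∈ powSpan (lower d k)
  exists_sub_mem : d ≤ n₅ k ∧ 1 ≤ n₃ k + d → ∃ m, Odd m ∧ m ≤ k ∧ n₃ m + 1 = n₃ k + d ∧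
    n₅ m + d = n₅ k ∧ T (Delta ^ k) - Delta ^ m ∈ powSpan (lower d k)

theorem LowersCode.mem_lowerEq {T : Module.End (ZMod 2) (ZMod 2)⟦X⟧} {d k : ℕ}
    (h : LowersCode T d k) : T (Delta ^ k) ∈ powSpan (lowerEq d k) := by
  by_cases hv : d ≤ n₅ k ∧ 1 ≤ n₃ k + d
  · obtain ⟨m, hm, -, h3, h5, hmem⟩ := h.exists_sub_mem hv
    rw [← sub_add_cancel (T (Delta ^ k)) (Delta ^ m)]
    exact add_mem (powSpan_mono (lower_subset_lowerEq d k) hmem)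
      (Delta_pow_mem_powSpan ⟨hm, .inr ⟨by omega, by omega⟩⟩)
  · exact powSpan_mono (lower_subset_lowerEq d k) (h.mem hv)

theorem odd_add_two_pow {e p : ℕ} (hp : p ≠ 0) (he : Odd e) : Odd (e + 2 ^ p) :=
  he.add_even ((Nat.even_pow.2 ⟨even_two, hp⟩))

/-- The code of `2 ^ (p + 2)` is twice that of `2 ^ p`. -/
theorem code_two_pow_add_two {p : ℕ} (hp : p ≠ 0) :
    n₃ (2 ^ (p + 2)) = 2 * n₃ (2 ^ p) ∧ n₅ (2 ^ (p + 2)) = 2 * n₅ (2 ^ p) := by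
  obtain ⟨i, ⟨rfl, h3, h5⟩ | ⟨rfl, h3, h5⟩⟩ := code_two_pow p hp
  · rw [h3, h5]
    exact ⟨(n₃_two_pow_odd (i + 1)).trans (pow_succ' 2 i), n₅_two_pow_odd (i + 1)⟩
  · rw [h3, h5]
    exact ⟨n₃_two_pow_even (i + 2), (n₅_two_pow_even (i + 1)).trans (pow_succ' 2 i)⟩

/-- An integer `m < 2 ^ (p + 2)` has the binary digit `2 ^ p` if both components of its code are at
least those of the code of `2 ^ p`. -/
theorem testBit_of_code_two_pow_le {m p : ℕ} (hp : p ≠ 0) (hm : m < 2 ^ (p + 2))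
    (h3 : n₃ (2 ^ p) ≤ n₃ m) (h5 : n₅ (2 ^ p) ≤ n₅ m) : m.testBit p = true := by
  by_contra hb
  rw [Bool.not_eq_true] at hb
  obtain ⟨i, ⟨rfl, h3', h5'⟩ | ⟨rfl, h3', h5'⟩⟩ := code_two_pow p hp
  · have := n₃_lt_of_testBit hm hb
    omega
  · have := n₅_lt_of_testBit hm hb
    omega

theorem code_two_pow_le_of_testBit {m p : ℕ} (hb : m.testBit p = true) :
    n₃ (2 ^ p) ≤ n₃ m ∧ n₅ (2 ^ p) ≤ n₅ m := by
  obtain ⟨l, hl, rfl⟩ := exists_eq_add_two_pow_of_testBit hb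
  rw [n₃_add_two_pow hl, n₅_add_two_pow hl]
  omega

theorem add_two_pow_lt {j p : ℕ} (hj : j < 2 ^ (p + 2)) (hb : j.testBit p = false) :
    j + 2 ^ p < 2 ^ (p + 2) := by
  have e4 : 2 ^ (p + 2) = 4 * 2 ^ p := by ring
  by_contra hlt
  have hdiv : j / 2 ^ p = 3 := Nat.div_eq_of_lt_le (by omega) (by omega)
  simp [Nat.testBit_eq_decide_div_mod_eq, hdiv] at hb

/-- The inductive step. Let `t = p + 2`, so that the code of `2 ^ t` is twice that of `2 ^ p`. Then
the leading term of `T (Delta ^ (j + 2 ^ t))` comes from `Delta ^ 2 ^ t * T (Delta ^ j)` if the code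
of `j` can be lowered. If it cannot, it comes from `Delta ^ 2 ^ p * T (Delta ^ (j + 2 ^ p))`,
provided the digit of `2 ^ p` belongs to the component of the code that is lowered. All other terms
are smaller, because their codes are or because of a carry. -/
theorem LowersCode.step {T : Module.End (ZMod 2) (ZMod 2)⟦X⟧} {d j p : ℕ} (hd : d ≤ 1)
    (hp : p ≠ 0) (hj : j < 2 ^ (p + 2)) {L : (ZMod 2)⟦X⟧}
    (hL : L ∈ powSpan (lower d (j + 2 ^ (p + 2))))
    (hT : T (Delta ^ (j + 2 ^ (p + 2))) = Delta ^ 2 ^ (p + 2) * T (Delta ^ j) +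
      Delta ^ 2 ^ p * T (Delta ^ (j + 2 ^ p)) + L)
    (h1 : LowersCode T d j) (h2 : LowersCode T d (j + 2 ^ p)) :
    LowersCode T d (j + 2 ^ (p + 2)) := by
  obtain ⟨w3, w5⟩ := code_two_pow_add_two hp
  have hbt : j.testBit (p + 2) = false := Nat.testBit_lt_two_pow hj
  have k3 := n₃_add_two_pow hbt
  have k5 := n₅_add_two_pow hbt
  have hjp := ord_add_two_pow hp j
  have hA : ∀ e ∈ lower d j, e + 2 ^ (p + 2) ∈ lower d (j + 2 ^ (p + 2)) := by
    rintro e ⟨ho, he⟩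
    have := ord_add_two_pow (Nat.succ_ne_zero (p + 1)) e
    refine ⟨odd_add_two_pow (by omega) ho, ?_⟩
    simp only [Nat.succ_eq_add_one, add_assoc, Nat.reduceAdd] at this
    omega
  have hB : ∀ e ∈ lower d (j + 2 ^ p), e + 2 ^ p ∈ lower d (j + 2 ^ (p + 2)) := by
    rintro e ⟨ho, he⟩
    have := ord_add_two_pow hp e
    refine ⟨odd_add_two_pow hp ho, ?_⟩
    omega
  -- If `j` has the digit `2 ^ p`, the carry in `j + 2 ^ p` makes all terms of the second
  -- summand small.
  have hB' : j.testBit p = true →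
      ∀ e ∈ lowerEq d (j + 2 ^ p), e + 2 ^ p ∈ lower d (j + 2 ^ (p + 2)) := by
    rintro hb e ⟨ho, he⟩
    have := ord_add_two_pow hp e
    refine ⟨odd_add_two_pow hp ho, ?_⟩
    simp only [hb, Bool.true_eq_false, false_and, or_false] at hjp
    omega
  by_cases hv : d ≤ n₅ j ∧ 1 ≤ n₃ j + d
  · refine ⟨fun h => absurd ?_ h, fun _ => ?_⟩
    · omega
    obtain ⟨m, hm, hmj, hm3, hm5, hmem⟩ := h1.exists_sub_mem hv
    have hmb : m.testBit (p + 2) = false := Nat.testBit_lt_two_pow (hmj.trans_lt hj)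
    refine ⟨m + 2 ^ (p + 2), odd_add_two_pow (by omega) hm, by omega, ?_, ?_, ?_⟩
    · rw [k3, n₃_add_two_pow hmb]; omega
    · rw [k5, n₅_add_two_pow hmb]; omega
    have hsecond : Delta ^ 2 ^ p * T (Delta ^ (j + 2 ^ p)) ∈
        powSpan (lower d (j + 2 ^ (p + 2))) := by
      cases hb : j.testBit p with
      | true => exact Delta_pow_mul_mem_powSpan _ h2.mem_lowerEq (hB' hb)
      | false =>
        have j3 := n₃_add_two_pow hb
        have j5 := n₅_add_two_pow hb
        obtain ⟨m', hm', hmj', hm3', hm5', hmem'⟩ := h2.exists_sub_mem (by omega)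
        -- The leading term `Delta ^ m'` of the second summand becomes small by a carry.
        have hmb' : m'.testBit p = true := by
          refine testBit_of_code_two_pow_le hp (hmj'.trans_lt (add_two_pow_lt hj hb)) ?_ ?_
          · omega
          · omega
        rw [← sub_add_cancel (T (Delta ^ (j + 2 ^ p))) (Delta ^ m'), mul_add, ← pow_add]
        refine add_mem (Delta_pow_mul_mem_powSpan _ hmem' hB) (Delta_pow_mem_powSpan ?_)
        rw [add_comm (2 ^ p) m']
        have := ord_add_two_pow hp m'
        simp only [hmb', Bool.true_eq_false, false_and, or_false] at this
        refine ⟨odd_add_two_pow hp hm', ?_⟩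
        omega
    rw [hT]
    have := Delta_pow_mul_mem_powSpan (2 ^ (p + 2)) hmem hA
    convert add_mem (add_mem this hsecond) hL using 1
    rw [mul_sub, ← pow_add, add_comm (2 ^ (p + 2)) m]
    ring
  · have hfirst := Delta_pow_mul_mem_powSpan (2 ^ (p + 2)) (h1.mem hv) hA
    cases hb : j.testBit p with
    | true =>
      have hw := code_two_pow_le_of_testBit hb
      refine ⟨fun _ => ?_, fun h => absurd ?_ hv⟩
      · rw [hT]
        exact add_mem (add_mem hfirst
          (Delta_pow_mul_mem_powSpan _ h2.mem_lowerEq (hB' hb))) hL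
      · omega
    | false =>
      have j3 := n₃_add_two_pow hb
      have j5 := n₅_add_two_pow hb
      refine ⟨fun h => ?_, fun h => ?_⟩
      · rw [hT]
        exact add_mem (add_mem hfirst
          (Delta_pow_mul_mem_powSpan _ (h2.mem (by omega)) hB)) hL
      · obtain ⟨m, hm, hmj, hm3, hm5, hmem⟩ := h2.exists_sub_mem (by omega)
        -- The lowered component of the code of `j + 2 ^ p` is `2 ^ i`, that of `m` is `2 ^ i - 1`,
        -- so there is no carry in `m + 2 ^ p`.
        have hmb : m.testBit p = false := by
          by_contra hmb
          have := code_two_pow_le_of_testBit (by simpa using hmb : m.testBit p = true)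
          obtain ⟨i, hi | hi⟩ := code_two_pow p hp <;> omega
        have e4 : 2 ^ (p + 2) = 4 * 2 ^ p := by ring
        refine ⟨m + 2 ^ p, odd_add_two_pow hp hm, by omega, ?_, ?_, ?_⟩
        · rw [k3, n₃_add_two_pow hmb]; omega
        · rw [k5, n₅_add_two_pow hmb]; omega
        rw [hT]
        convert add_mem (add_mem hfirst (Delta_pow_mul_mem_powSpan (2 ^ p) hmem hB)) hL using 1
        rw [mul_sub, ← pow_add, add_comm (2 ^ p) m]
        ring

/-! ### Dominant terms of the images of powers of `Delta` under `T₃` and `T₅` -/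

theorem LowersCode.of_eq_zero {T : Module.End (ZMod 2) (ZMod 2)⟦X⟧} {d k : ℕ}
    (hT : T (Delta ^ k) = 0) (hk : ¬ (d ≤ n₅ k ∧ 1 ≤ n₃ k + d)) : LowersCode T d k :=
  ⟨fun _ => hT ▸ zero_mem _, fun h => absurd h hk⟩

theorem LowersCode.of_eq_add {T : Module.End (ZMod 2) (ZMod 2)⟦X⟧} {d k m : ℕ} {s : Finset ℕ}
    (hT : T (Delta ^ k) = Delta ^ m + ∑ e ∈ s, Delta ^ e)
    (hm : Odd m ∧ m ≤ k ∧ n₃ m + 1 = n₃ k + d ∧ n₅ m + d = n₅ k)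
    (hs : ∀ e ∈ s, Odd e ∧ (n₃ e + n₅ e + 1 < n₃ k + n₅ k ∨
      (n₃ e + n₅ e + 1 = n₃ k + n₅ k ∧ n₅ e + d < n₅ k))) : LowersCode T d k := by
  refine ⟨fun h => absurd (by omega) h, fun _ => ⟨m, hm.1, hm.2.1, hm.2.2.1, hm.2.2.2, ?_⟩⟩
  rw [hT, add_sub_cancel_left]
  exact sum_mem fun e he => Delta_pow_mem_powSpan (hs e he)

/-- Splitting off the leading binary digit. -/
theorem exists_eq_add_two_pow {k t : ℕ} (hk : 2 ^ (t + 2) ≤ k) :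
    ∃ p j, t ≤ p ∧ j < 2 ^ (p + 2) ∧ k = j + 2 ^ (p + 2) := by
  have hk0 : k ≠ 0 := by
    rintro rfl
    simp at hk
  have h1 : t + 2 ≤ Nat.log 2 k := (Nat.le_log_iff_pow_le one_lt_two hk0).2 hk
  have h2 := Nat.pow_log_le_self 2 hk0
  have h3 := Nat.lt_pow_succ_log_self one_lt_two k
  refine ⟨Nat.log 2 k - 2, k - 2 ^ Nat.log 2 k, by omega, ?_, ?_⟩
  · rw [Nat.sub_add_cancel (by omega)]
    rw [pow_succ] at h3
    omega
  · rw [Nat.sub_add_cancel (by omega)]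
    omega

theorem hecke_three_lowersCode {k : ℕ} (hk : Odd k) : LowersCode (hecke 3) 0 k := by
  induction k using Nat.strong_induction_on with
  | _ k ih =>
  rcases Nat.lt_or_ge k 8 with hk8 | hk8
  · have hodd : Odd 3 := by decide
    have v1 : hecke 3 (Delta ^ 1) = 0 := by
      rw [pow_one]
      exact hecke_Delta Nat.prime_three hodd
    have v2 : hecke 3 (Delta ^ 2) = 0 := by
      rw [hecke_Delta_pow_two_mul hodd 1, v1, zero_pow two_ne_zero]
    have v4 : hecke 3 (Delta ^ 4) = 0 := by
      rw [hecke_Delta_pow_two_mul hodd 2, v2, zero_pow two_ne_zero]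
    have v5 : hecke 3 (Delta ^ 5) = 0 := by
      have := hecke_three_pow_add 0 1
      norm_num at this v1
      simpa [v1, v2] using this
    have v7 : hecke 3 (Delta ^ 7) = Delta ^ 5 := by
      have := hecke_three_pow_add 0 3
      norm_num [v4, hecke_three_pow_three] at this
      rw [this]
      ring
    have : k = 1 ∨ k = 3 ∨ k = 5 ∨ k = 7 := by
      obtain ⟨i, rfl⟩ := hk
      omega
    rcases this with rfl | rfl | rfl | rfl
    · exact .of_eq_zero v1 (by decide)
    · exact .of_eq_add (m := 1) (s := ∅) (by simp [hecke_three_pow_three]) (by decide) (by decide)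
    · exact .of_eq_zero v5 (by decide)
    · exact .of_eq_add (m := 5) (s := ∅) (by simp [v7]) (by decide) (by decide)
  · obtain ⟨p, j, hp, hj, rfl⟩ := exists_eq_add_two_pow (t := 1) hk8
    have h4 : 2 ^ (p + 2) = 4 * 2 ^ p := by ring
    have hj' : Odd j := (Nat.odd_add.1 hk).2 (Nat.even_pow.2 ⟨even_two, by omega⟩)
    have hpos : 0 < 2 ^ p := by positivity
    refine LowersCode.step zero_le_one (by omega) hj (zero_mem _) ?_ (ih j (by omega) hj')
      (ih _ (by omega) (odd_add_two_pow (by omega) hj'))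
    rw [h4, hecke_three_pow_add]
    ring

theorem hecke_five_lowersCode_of_lt {k : ℕ} (hk : Odd k) (hlt : k < 32) :
    LowersCode (hecke 5) 1 k := by
  have hodd : Odd 5 := by decide
  have sq : ∀ n, hecke 5 (Delta ^ (2 * n)) = hecke 5 (Delta ^ n) ^ 2 :=
    hecke_Delta_pow_two_mul hodd
  have v1 : hecke 5 (Delta ^ 1) = 0 := by
    rw [pow_one]
    exact hecke_Delta Nat.prime_five hodd
  have v2 : hecke 5 (Delta ^ 2) = 0 := by rw [sq 1, v1, zero_pow two_ne_zero]
  have v3 := hecke_five_pow_three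
  have v4 : hecke 5 (Delta ^ 4) = 0 := by rw [sq 2, v2, zero_pow two_ne_zero]
  have v5 := hecke_five_pow_five
  have v6 : hecke 5 (Delta ^ 6) = 0 := by rw [sq 3, v3, zero_pow two_ne_zero]
  have v7 : hecke 5 (Delta ^ 7) = Delta ^ 3 := by
    rw [hecke_five_pow_add_six 1, v5, v3, v2, v1]
    ring
  have v8 : hecke 5 (Delta ^ 8) = 0 := by rw [sq 4, v4, zero_pow two_ne_zero]
  have v9 : hecke 5 (Delta ^ 9) = 0 := by
    rw [hecke_five_pow_add_six 3, v7, v5, v4, v3]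
    linear_combination Delta ^ 5 * two_eq_zero_powerSeries
  have v10 : hecke 5 (Delta ^ 10) = Delta ^ 2 := by rw [sq 5, v5]
  have v11 : hecke 5 (Delta ^ 11) = 0 := by
    rw [hecke_five_pow_add_six 5, v9, v7, v6, v5]
    linear_combination Delta ^ 7 * two_eq_zero_powerSeries
  have v12 : hecke 5 (Delta ^ 12) = 0 := by rw [sq 6, v6, zero_pow two_ne_zero]
  have v13 : hecke 5 (Delta ^ 13) = Delta ^ 9 := by
    rw [hecke_five_pow_add_six 7, v11, v9, v8, v7]
    ring
  have v14 : hecke 5 (Delta ^ 14) = Delta ^ 6 := by rw [sq 7, v7, ← pow_mul]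
  have v15 : hecke 5 (Delta ^ 15) = Delta ^ 11 + Delta ^ 3 := by
    rw [hecke_five_pow_add_six 9, v13, v11, v10, v9]
    ring
  have v16 : hecke 5 (Delta ^ 16) = 0 := by rw [sq 8, v8, zero_pow two_ne_zero]
  have hrec : ∀ j, hecke 5 (Delta ^ (j + 16)) = Delta ^ 16 * hecke 5 (Delta ^ j) +
      Delta ^ 4 * hecke 5 (Delta ^ (j + 4)) + Delta ^ 8 * hecke 5 (Delta ^ j) +
      Delta ^ 3 * hecke 5 (Delta ^ (j + 1)) := hecke_five_pow_add 0
  have v17 : hecke 5 (Delta ^ 17) = Delta ^ 5 := by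
    rw [hrec 1, v1, v5, v2]
    ring
  have v19 : hecke 5 (Delta ^ 19) = Delta ^ 7 := by
    rw [hrec 3, v3, v7, v4]
    ring
  have v21 : hecke 5 (Delta ^ 21) = Delta ^ 17 + Delta ^ 9 := by
    rw [hrec 5, v5, v9, v6]
    ring
  have v23 : hecke 5 (Delta ^ 23) = Delta ^ 19 + Delta ^ 11 := by
    rw [hrec 7, v7, v11, v8]
    ring
  have v25 : hecke 5 (Delta ^ 25) = Delta ^ 13 + Delta ^ 5 := by
    rw [hrec 9, v9, v13, v10]
    ring
  have v27 : hecke 5 (Delta ^ 27) = Delta ^ 15 + Delta ^ 7 := by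
    rw [hrec 11, v11, v15, v12]
    ring
  have v29 : hecke 5 (Delta ^ 29) = Delta ^ 25 + Delta ^ 17 := by
    rw [hrec 13, v13, v17, v14]
    linear_combination Delta ^ 9 * two_eq_zero_powerSeries
  have v31 : hecke 5 (Delta ^ 31) = Delta ^ 27 := by
    rw [hrec 15, v15, v19, v16]
    linear_combination (Delta ^ 19 + Delta ^ 11) * two_eq_zero_powerSeries
  obtain ⟨i, rfl⟩ := hk
  have hi : i < 16 := by omega
  interval_cases i
  · exact .of_eq_zero v1 (by decide)
  · exact .of_eq_zero v3 (by decide)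
  · exact .of_eq_add (m := 1) (s := ∅) (by simp [v5]) (by decide) (by decide)
  · exact .of_eq_add (m := 3) (s := ∅) (by simp [v7]) (by decide) (by decide)
  · exact .of_eq_zero v9 (by decide)
  · exact .of_eq_zero v11 (by decide)
  · exact .of_eq_add (m := 9) (s := ∅) (by simp [v13]) (by decide) (by decide)
  · exact .of_eq_add (m := 11) (s := {3}) (by simp [v15]) (by decide) (by decide)
  · exact .of_eq_add (m := 5) (s := ∅) (by simp [v17]) (by decide) (by decide)
  · exact .of_eq_add (m := 7) (s := ∅) (by simp [v19]) (by decide) (by decide)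
  · exact .of_eq_add (m := 17) (s := {9}) (by simp [v21]) (by decide) (by decide)
  · exact .of_eq_add (m := 19) (s := {11}) (by simp [v23]) (by decide) (by decide)
  · exact .of_eq_add (m := 13) (s := {5}) (by simp [v25]) (by decide) (by decide)
  · exact .of_eq_add (m := 15) (s := {7}) (by simp [v27]) (by decide) (by decide)
  · exact .of_eq_add (m := 25) (s := {17}) (by simp [v29]) (by decide) (by decide)
  · exact .of_eq_add (m := 27) (s := ∅) (by simp [v31]) (by decide) (by decide)

/-- The pair `(h, n₅)` is strictly increasing along the powers `2 ^ p` with `p ≠ 0`. -/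
theorem ord_two_pow_lt {p : ℕ} (hp : p ≠ 0) :
    n₃ (2 ^ p) + n₅ (2 ^ p) < n₃ (2 ^ (p + 1)) + n₅ (2 ^ (p + 1)) ∨
    (n₃ (2 ^ p) + n₅ (2 ^ p) = n₃ (2 ^ (p + 1)) + n₅ (2 ^ (p + 1)) ∧
      n₅ (2 ^ p) < n₅ (2 ^ (p + 1))) := by
  obtain ⟨i, ⟨rfl, h3, h5⟩ | ⟨rfl, h3, h5⟩⟩ := code_two_pow p hp
  · have h3' : n₃ (2 ^ (2 * i + 1 + 1)) = 0 := n₃_two_pow_even (i + 1)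
    have h5' : n₅ (2 ^ (2 * i + 1 + 1)) = 2 ^ i := n₅_two_pow_even i
    have := Nat.two_pow_pos i
    omega
  · have h3' : n₃ (2 ^ (2 * i + 2 + 1)) = 2 ^ (i + 1) := n₃_two_pow_odd (i + 1)
    have h5' : n₅ (2 ^ (2 * i + 2 + 1)) = 0 := n₅_two_pow_odd (i + 1)
    have := Nat.two_pow_pos i
    have : 2 ^ (i + 1) = 2 * 2 ^ i := by ring
    omega

theorem hecke_five_lowersCode {k : ℕ} (hk : Odd k) : LowersCode (hecke 5) 1 k := by
  induction k using Nat.strong_induction_on with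
  | _ k ih =>
  rcases Nat.lt_or_ge k 32 with hk32 | hk32
  · exact hecke_five_lowersCode_of_lt hk hk32
  · obtain ⟨p, j, hp, hj, rfl⟩ := exists_eq_add_two_pow (t := 3) hk32
    obtain ⟨s, rfl⟩ : ∃ s, p = s + 3 := ⟨p - 3, by omega⟩
    have hj' : Odd j := (Nat.odd_add.1 hk).2 (Nat.even_pow.2 ⟨even_two, by omega⟩)
    have hpos : 0 < 2 ^ s := by positivity
    have e1 : 2 ^ (s + 1) = 2 * 2 ^ s := by ring
    have e3 : 2 ^ (s + 3) = 8 * 2 ^ s := by ring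
    have e5 : 2 ^ (s + 3 + 2) = 32 * 2 ^ s := by ring
    have hL1 := Delta_pow_mul_mem_powSpan (T := lower 1 (j + 2 ^ (s + 3 + 2))) (2 ^ (s + 4))
      (ih j (by omega) hj').mem_lowerEq
    have hL2 := Delta_pow_mul_mem_powSpan (T := lower 1 (j + 2 ^ (s + 3 + 2)))
      (2 ^ (s + 1) + 2 ^ (s + 2))
      (ih (j + 2 ^ (s + 1)) (by omega) (odd_add_two_pow (by omega) hj')).mem_lowerEq
    have hbt : j.testBit (s + 3 + 2) = false := Nat.testBit_lt_two_pow hj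
    have k3 := n₃_add_two_pow hbt
    have k5 := n₅_add_two_pow hbt
    obtain ⟨w3, w5⟩ := code_two_pow_add_two (p := s + 3) (by omega)
    obtain ⟨u3, u5⟩ := code_two_pow_add_two (p := s + 1) (by omega)
    have l1 := ord_two_pow_lt (p := s + 2) (by omega)
    have l2 := ord_two_pow_lt (p := s + 4) (by omega)
    simp only [add_assoc, Nat.reduceAdd] at *
    refine LowersCode.step (p := s + 3) le_rfl (by omega) hj (add_mem (hL1 ?_) (hL2 ?_)) ?_
      (ih j (by omega) hj') (ih _ (by omega) (odd_add_two_pow (by omega) hj'))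
    -- The last two summands of the recurrence are small: the code of `2 ^ (s + 4)` and the sum of
    -- the codes of `2 ^ (s + 1)`, `2 ^ (s + 1)`, `2 ^ (s + 2)` are less than that of `2 ^ (s + 5)`.
    · rintro e ⟨ho, he⟩
      have := ord_add_two_pow (p := s + 4) (by omega) e
      refine ⟨odd_add_two_pow (by omega) ho, ?_⟩
      omega
    · rintro e ⟨ho, he⟩
      have a1 := ord_add_two_pow (p := s + 1) (by omega) e
      have a2 := ord_add_two_pow (p := s + 2) (by omega) (e + 2 ^ (s + 1))
      have a3 := ord_add_two_pow (p := s + 1) (by omega) j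
      rw [← add_assoc]
      refine ⟨odd_add_two_pow (by omega) (odd_add_two_pow (by omega) ho), ?_⟩
      omega
    · have := hecke_five_pow_add (s + 1) j
      have f5 : 16 * 2 ^ (s + 1) = 2 ^ (s + 3 + 2) := by ring
      have f3 : 4 * 2 ^ (s + 1) = 2 ^ (s + 3) := by ring
      have f4 : 8 * 2 ^ (s + 1) = 2 ^ (s + 4) := by ring
      have f2 : 3 * 2 ^ (s + 1) = 2 ^ (s + 1) + 2 ^ (s + 2) := by ring
      rw [f5, f3, f4, f2] at this
      rw [this]
      ring

/-! ### Dominant exponents -/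

theorem exists_sum_of_mem_powSpan {S : Set ℕ} {f : (ZMod 2)⟦X⟧} (hf : f ∈ powSpan S) :
    ∃ s : Finset ℕ, (∀ e ∈ s, e ∈ S) ∧ f = ∑ e ∈ s, Delta ^ e := by
  obtain ⟨c, hc, rfl⟩ := (Finsupp.mem_span_image_iff_linearCombination (ZMod 2)).1 hf
  refine ⟨c.support, fun e he => hc he, ?_⟩
  rw [Finsupp.linearCombination_apply, Finsupp.sum]
  refine Finset.sum_congr rfl fun e he => ?_
  have h1 : ∀ a : ZMod 2, a ≠ 0 → a = 1 := by decide
  rw [h1 _ (Finsupp.mem_support_iff.1 he), one_smul]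

theorem sum_mem_powSpan {S : Set ℕ} {s : Finset ℕ} (hs : ∀ e ∈ s, e ∈ S) :
    ∑ e ∈ s, Delta ^ e ∈ powSpan S :=
  sum_mem fun e he => Delta_pow_mem_powSpan (hs e he)

theorem exponents_subset {S : Set ℕ} {f : (ZMod 2)⟦X⟧} (hf : f ∈ powSpan S) :
    ∀ e ∈ exponents f, e ∈ S := by
  obtain ⟨s, hs, rfl⟩ := exists_sum_of_mem_powSpan hf
  rwa [exponents_sum]

theorem oddForms_eq_powSpan : oddForms = powSpan {k | Odd k} := by
  rw [oddForms, powSpan]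
  congr 1
  ext f
  simp [eq_comm]

theorem powSpan_le_oddForms {S : Set ℕ} (hS : ∀ e ∈ S, Odd e) : powSpan S ≤ oddForms :=
  oddForms_eq_powSpan ▸ powSpan_mono hS

/-- The odd exponents dominated by `m`. -/
def below (m : ℕ) : Set ℕ := {e | Odd e ∧ Dominated e m}

/-- The exponent `m` is odd and `f` is the sum of `Delta ^ m` and of powers of `Delta` with odd
exponents dominated by `m`. -/
def Leads (f : (ZMod 2)⟦X⟧) (m : ℕ) : Prop := Odd m ∧ f - Delta ^ m ∈ powSpan (below m)

theorem not_dominated_self (m : ℕ) : ¬ Dominated m m := by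
  unfold Dominated
  omega

theorem dominated_or_dominated {k l : ℕ} (hk : Odd k) (hl : Odd l) (h : k ≠ l) :
    Dominated k l ∨ Dominated l k := by
  by_contra hn
  refine h (eq_of_code_eq ?_ ?_ ?_)
  · rw [Nat.odd_iff.1 hk, Nat.odd_iff.1 hl]
  all_goals
    simp only [Dominated, HeckeModTwo.h] at hn
    omega

/-- Every nonzero form has a dominant exponent. -/
theorem exists_leads {f : (ZMod 2)⟦X⟧} (hf : f ∈ oddForms) (hf0 : f ≠ 0) : ∃ m, Leads f m := by
  obtain ⟨s, hs, rfl⟩ := exists_sum_of_mem_powSpan (oddForms_eq_powSpan ▸ hf)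
  have hne : s.Nonempty := Finset.nonempty_iff_ne_empty.2 (by rintro rfl; simp at hf0)
  obtain ⟨m, hm, hmax⟩ := s.exists_max_image (fun k => toLex (h k, n₅ k)) hne
  refine ⟨m, hs m hm, ?_⟩
  rw [← Finset.sum_erase_eq_sub hm]
  refine sum_mem_powSpan fun e he => ⟨hs e (Finset.mem_of_mem_erase he), ?_⟩
  refine (dominated_or_dominated (hs e (Finset.mem_of_mem_erase he)) (hs m hm)
    (Finset.ne_of_mem_erase he)).resolve_right fun hd => ?_
  refine (hmax e (Finset.mem_of_mem_erase he)).not_gt ?_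
  rw [Prod.Lex.toLex_lt_toLex]
  exact hd

theorem Leads.exponents_eq {f : (ZMod 2)⟦X⟧} {m : ℕ} (hf : Leads f m) :
    ∃ s : Finset ℕ, (∀ e ∈ s, e ∈ below m) ∧ exponents f = insert m s := by
  obtain ⟨s, hs, he⟩ := exists_sum_of_mem_powSpan hf.2
  refine ⟨s, hs, ?_⟩
  have hms : m ∉ s := fun hm => not_dominated_self m (hs m hm).2
  rw [sub_eq_iff_eq_add', ← Finset.sum_insert hms] at he
  rw [he, exponents_sum]

theorem Leads.isDominantExponent {f : (ZMod 2)⟦X⟧} {m : ℕ} (hf : Leads f m) :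
    IsDominantExponent f m := by
  obtain ⟨s, hs, he⟩ := hf.exponents_eq
  rw [IsDominantExponent, he]
  refine ⟨Finset.mem_insert_self m s, fun k hk hkm => ?_⟩
  exact (hs k ((Finset.mem_insert.1 hk).resolve_left hkm)).2

theorem Leads.hForm_eq {f : (ZMod 2)⟦X⟧} {m : ℕ} (hf : Leads f m) : hForm f = h m := by
  obtain ⟨s, hs, he⟩ := hf.exponents_eq
  rw [hForm, he, Finset.sup_insert, sup_eq_left]
  refine Finset.sup_le fun e hes => ?_
  have hd := (hs e hes).2
  have hle : h e ≤ h m := by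
    unfold Dominated at hd
    omega
  exact_mod_cast hle

theorem exponents_zero : exponents 0 = ∅ := by
  rw [← Finset.sum_empty (f := fun k => Delta ^ k), exponents_sum]

theorem Leads.ne_zero {f : (ZMod 2)⟦X⟧} {m : ℕ} (hf : Leads f m) : f ≠ 0 := by
  rintro rfl
  simpa [exponents_zero] using hf.isDominantExponent.1

/-- The space spanned by the powers `Delta ^ e` with `e` odd and `h e < H`. -/
noncomputable def heightLT (H : ℕ) : Submodule (ZMod 2) (ZMod 2)⟦X⟧ :=
  powSpan {e | Odd e ∧ h e < H}

theorem Leads.mem_heightLT {f : (ZMod 2)⟦X⟧} {m H : ℕ} (hf : Leads f m) (hH : h m < H) :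
    f ∈ heightLT H := by
  rw [← sub_add_cancel f (Delta ^ m)]
  refine add_mem (powSpan_mono ?_ hf.2) (Delta_pow_mem_powSpan ⟨hf.1, hH⟩)
  rintro e ⟨ho, hd⟩
  refine ⟨ho, ?_⟩
  unfold Dominated at hd
  omega

theorem heightLT_mono : Monotone heightLT :=
  fun _ _ hH => powSpan_mono fun _ he => ⟨he.1, he.2.trans_le hH⟩

theorem heightLT_zero : heightLT 0 = ⊥ := by
  rw [eq_bot_iff]
  exact powSpan_le fun e he => absurd he.2 (Nat.not_lt_zero _)

theorem eq_one_of_h_eq_zero {e : ℕ} (he : Odd e) (h0 : h e = 0) : e = 1 := by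
  have h1 : n₅ 1 = 0 := by rw [n₅_eq]; rfl
  refine eq_of_code_eq (Nat.odd_iff.1 he) ?_ ?_ <;> simp only [h, n₃_one, h1] at * <;> omega

theorem hecke_mem_of_lowersCode {T : Module.End (ZMod 2) (ZMod 2)⟦X⟧} {d : ℕ}
    (hT : ∀ k, Odd k → LowersCode T d k) {H : ℕ} {f : (ZMod 2)⟦X⟧} (hf : f ∈ heightLT (H + 1)) :
    T f ∈ heightLT H := by
  have : heightLT (H + 1) ≤ (heightLT H).comap T := by
    refine powSpan_le fun e he => powSpan_mono ?_ (hT e he.1).mem_lowerEq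
    rintro k ⟨hk, hke⟩
    refine ⟨hk, ?_⟩
    have := he.2
    simp only [h] at *
    omega
  exact this hf

theorem Leads.exists_apply {T : Module.End (ZMod 2) (ZMod 2)⟦X⟧} {d : ℕ}
    (hT : ∀ k, Odd k → LowersCode T d k) {f : (ZMod 2)⟦X⟧} {m : ℕ} (hf : Leads f m)
    (hv : d ≤ n₅ m ∧ 1 ≤ n₃ m + d) :
    ∃ m', Leads (T f) m' ∧ n₃ m' + 1 = n₃ m + d ∧ n₅ m' + d = n₅ m := by
  obtain ⟨m', ho, -, h3, h5, hmem⟩ := (hT m hf.1).exists_sub_mem hv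
  refine ⟨m', ⟨ho, ?_⟩, h3, h5⟩
  have h1 : powSpan (below m) ≤ (powSpan (lower d m)).comap T := by
    refine powSpan_le fun e he => powSpan_mono ?_ (hT e he.1).mem_lowerEq
    rintro k ⟨hk, hke⟩
    refine ⟨hk, ?_⟩
    have := he.2
    simp only [Dominated, h] at this
    omega
  have h2 : T (f - Delta ^ m) ∈ powSpan (lower d m) := h1 hf.2
  replace h2 := add_mem h2 hmem
  rw [map_sub, sub_add_sub_cancel] at h2
  refine powSpan_mono ?_ h2
  rintro k ⟨hk, hke⟩
  refine ⟨hk, ?_⟩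
  simp only [Dominated, h]
  omega

theorem Leads.exists_three_pow {f : (ZMod 2)⟦X⟧} {m : ℕ} (hf : Leads f m) {a : ℕ}
    (ha : a ≤ n₃ m) : ∃ m', Leads ((hecke 3 ^ a) f) m' ∧ n₃ m' + a = n₃ m ∧ n₅ m' = n₅ m := by
  induction a with
  | zero => exact ⟨m, hf, rfl, rfl⟩
  | succ a ih =>
    obtain ⟨l, hl, h3, h5⟩ := ih (by omega)
    obtain ⟨l', hl', h3', h5'⟩ := hl.exists_apply (fun k hk => hecke_three_lowersCode hk)
      (by omega)
    rw [pow_succ', Module.End.mul_apply]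
    exact ⟨l', hl', by omega, by omega⟩

theorem Leads.exists_five_pow {f : (ZMod 2)⟦X⟧} {m : ℕ} (hf : Leads f m) {b : ℕ}
    (hb : b ≤ n₅ m) : ∃ m', Leads ((hecke 5 ^ b) f) m' ∧ n₃ m' = n₃ m ∧ n₅ m' + b = n₅ m := by
  induction b with
  | zero => exact ⟨m, hf, rfl, rfl⟩
  | succ b ih =>
    obtain ⟨l, hl, h3, h5⟩ := ih (by omega)
    obtain ⟨l', hl', h3', h5'⟩ := hl.exists_apply (fun k hk => hecke_five_lowersCode hk)
      (by omega)
    rw [pow_succ', Module.End.mul_apply]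
    exact ⟨l', hl', by omega, by omega⟩

/-- Lowering the code of the dominant exponent to `[0, 0]` leaves only `Delta`. -/
theorem Leads.apply_eq_Delta {f : (ZMod 2)⟦X⟧} {m : ℕ} (hf : Leads f m) :
    (hecke 3 ^ n₃ m * hecke 5 ^ n₅ m) f = Delta := by
  obtain ⟨l, hl, h3, h5⟩ := hf.exists_five_pow le_rfl
  obtain ⟨l', hl', h3', h5'⟩ := hl.exists_three_pow le_rfl
  have h1 : l' = 1 := eq_one_of_h_eq_zero hl'.1 (by simp only [h]; omega)
  subst h1
  have hbelow : below 1 = ∅ := by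
    refine Set.eq_empty_of_forall_notMem fun e he => ?_
    have := he.2
    simp only [Dominated, h] at this
    omega
  have := hl'.2
  rw [hbelow, powSpan, Set.image_empty, Submodule.span_empty, Submodule.mem_bot, sub_eq_zero,
    pow_one, h3] at this
  exact this

/-! ### The order of nilpotence -/

section

open PowerSeries

/-- The series all of whose exponents are odd. -/
def oddSeries : Submodule (ZMod 2) (ZMod 2)⟦X⟧ where
  carrier := {f | ∀ n, Even n → coeff n f = 0}
  zero_mem' := fun _ _ => map_zero _
  add_mem' := fun hf hg n hn => by rw [map_add, hf n hn, hg n hn, add_zero]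
  smul_mem' := fun a f hf n hn => by rw [map_smul, hf n hn, smul_zero]

theorem coeff_sq_of_odd (f : (ZMod 2)⟦X⟧) {n : ℕ} (hn : Odd n) : coeff n (f ^ 2) = 0 := by
  rw [sq_eq_expand, coeff_expand, if_neg]
  rintro h
  exact Nat.not_even_iff_odd.2 hn (even_iff_two_dvd.2 h)

theorem sq_mul_mem_oddSeries (f : (ZMod 2)⟦X⟧) {g : (ZMod 2)⟦X⟧} (hg : g ∈ oddSeries) :
    f ^ 2 * g ∈ oddSeries := by
  intro n hn
  rw [coeff_mul]
  refine Finset.sum_eq_zero fun x hx => ?_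
  rcases Nat.even_or_odd x.1 with h | h
  · rw [hg x.2, mul_zero]
    rw [← Finset.HasAntidiagonal.mem_antidiagonal.1 hx] at hn
    exact (Nat.even_add.1 hn).1 h
  · rw [coeff_sq_of_odd f h, zero_mul]

theorem Delta_mem_oddSeries : Delta ∈ oddSeries := by
  classical
  intro n hn
  rw [coeff_Delta, if_neg]
  rintro ⟨m, rfl⟩
  exact Nat.not_even_iff_odd.2 (Odd.pow ⟨m, rfl⟩) hn

theorem oddForms_le_oddSeries : oddForms ≤ oddSeries := by
  rw [oddForms_eq_powSpan]
  refine powSpan_le ?_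
  rintro _ ⟨i, rfl⟩
  rw [pow_succ, mul_comm 2 i, pow_mul]
  exact sq_mul_mem_oddSeries _ Delta_mem_oddSeries

theorem hecke_mem_oddSeries {p : ℕ} (hp : Odd p) {f : (ZMod 2)⟦X⟧} (hf : f ∈ oddSeries) :
    hecke p f ∈ oddSeries := by
  intro n hn
  rw [coeff_hecke, hf _ (hn.mul_left p), zero_add]
  split_ifs with h
  · obtain ⟨k, rfl⟩ := h
    rw [Nat.mul_div_cancel_left _ hp.pos]
    exact hf k ((Nat.even_mul.1 hn).resolve_left (Nat.not_even_iff_odd.2 hp))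
  · rfl

theorem adjoin_Delta_le_powSpan :
    Subalgebra.toSubmodule (Algebra.adjoin (ZMod 2) {Delta}) ≤ powSpan Set.univ := by
  intro f hf
  rw [Subalgebra.mem_toSubmodule, Algebra.adjoin_singleton_eq_range_aeval] at hf
  obtain ⟨P, rfl⟩ := hf
  change Polynomial.aeval Delta P ∈ _
  rw [Polynomial.aeval_eq_sum_range]
  exact sum_mem fun i _ => Submodule.smul_mem _ _ (Delta_pow_mem_powSpan (Set.mem_univ i))

/-- A polynomial in `Delta` with only odd exponents in its `q`-expansion has only odd powers of
`Delta`: its even part is the square of a series, whose exponents are even. -/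
theorem mem_oddForms_of_mem_adjoin {f : (ZMod 2)⟦X⟧} (hf : f ∈ Algebra.adjoin (ZMod 2) {Delta})
    (hodd : f ∈ oddSeries) : f ∈ oddForms := by
  obtain ⟨s, -, rfl⟩ := exists_sum_of_mem_powSpan (adjoin_Delta_le_powSpan hf)
  rw [← Finset.sum_filter_add_sum_filter_not s Even] at hodd ⊢
  have h1 : ∑ e ∈ s with ¬ Even e, Delta ^ e ∈ oddForms :=
    oddForms_eq_powSpan ▸ sum_mem_powSpan fun e he =>
      Nat.not_even_iff_odd.1 (Finset.mem_filter.1 he).2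
  have h2 : ∑ e ∈ s with Even e, Delta ^ e ∈ oddSeries := by
    simpa using sub_mem hodd (oddForms_le_oddSeries h1)
  have h3 : ∑ e ∈ s with Even e, Delta ^ e = (∑ e ∈ s with Even e, Delta ^ (e / 2)) ^ 2 := by
    rw [sum_pow_char]
    refine Finset.sum_congr rfl fun e he => ?_
    rw [← pow_mul, Nat.div_mul_cancel (Finset.mem_filter.1 he).2.two_dvd]
  have h4 : ∑ e ∈ s with Even e, Delta ^ e = 0 := by
    ext n
    rcases Nat.even_or_odd n with hn | hn
    · rw [h2 n hn, map_zero]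
    · rw [h3, coeff_sq_of_odd _ hn, map_zero]
  rwa [h4, zero_add]

theorem hecke_mem_oddForms {p : ℕ} (hp : p.Prime) (hodd : Odd p) {f : (ZMod 2)⟦X⟧}
    (hf : f ∈ oddForms) : hecke p f ∈ oddForms := by
  have h : oddForms ≤ (Subalgebra.toSubmodule (Algebra.adjoin (ZMod 2) {Delta})).comap
      (hecke p) := by
    rw [oddForms_eq_powSpan]
    exact powSpan_le fun e _ => hecke_Delta_pow_mem_adjoin hp hodd e
  exact mem_oddForms_of_mem_adjoin (h hf) (hecke_mem_oddSeries hodd (oddForms_le_oddSeries hf))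

/-- The only odd exponent of height `0` is `1`, and `T_p` annihilates `Delta`. -/
theorem heightLT_one_le_ker {p : ℕ} (hp : p.Prime) (hodd : Odd p) :
    heightLT 1 ≤ LinearMap.ker (hecke p) := by
  refine powSpan_le fun e he => ?_
  rw [eq_one_of_h_eq_zero he.1 (Nat.lt_one_iff.1 he.2), pow_one, LinearMap.mem_ker,
    hecke_Delta hp hodd]

theorem pow_apply_mem_heightLT {T : Module.End (ZMod 2) (ZMod 2)⟦X⟧} {d : ℕ}
    (hT : ∀ k, Odd k → LowersCode T d k) {H a : ℕ} {f : (ZMod 2)⟦X⟧}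
    (hf : f ∈ heightLT (H + a)) : (T ^ a) f ∈ heightLT H := by
  induction a generalizing f with
  | zero => exact hf
  | succ a ih =>
    rw [pow_succ, Module.End.mul_apply]
    exact ih (hecke_mem_of_lowersCode hT hf)

/-- Every Hecke operator lowers the height. Otherwise some product of powers of `T₃` and `T₅`
would send `hecke p f` to `Delta` and `f` to a multiple of `Delta`, which `hecke p` annihilates. -/
theorem hecke_mem_heightLT {p : ℕ} (hp : p.Prime) (hodd : Odd p) {H : ℕ} {f : (ZMod 2)⟦X⟧}
    (hf : f ∈ heightLT (H + 1)) : hecke p f ∈ heightLT H := by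
  rcases eq_or_ne (hecke p f) 0 with h0 | h0
  · exact h0 ▸ zero_mem _
  obtain ⟨m, hm⟩ := exists_leads
    (hecke_mem_oddForms hp hodd (powSpan_le_oddForms (fun _ he => he.1) hf)) h0
  refine hm.mem_heightLT (lt_of_not_ge fun hH => ?_)
  have h1 : (hecke 3 ^ n₃ m * hecke 5 ^ n₅ m) f ∈ heightLT 1 := by
    rw [Module.End.mul_apply]
    refine pow_apply_mem_heightLT (fun k hk => hecke_three_lowersCode hk)
      (pow_apply_mem_heightLT (fun k hk => hecke_five_lowersCode hk) (heightLT_mono ?_ hf))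
    simp only [h] at hH
    omega
  have hc : Commute (hecke p) (hecke 3 ^ n₃ m * hecke 5 ^ n₅ m) :=
    ((show Commute (hecke p) (hecke 3) from
      LinearMap.ext fun g => hecke_comm hp Nat.prime_three g).pow_right _).mul_right
    ((show Commute (hecke p) (hecke 5) from
      LinearMap.ext fun g => hecke_comm hp Nat.prime_five g).pow_right _)
  have h2 := hm.apply_eq_Delta
  rw [← Module.End.mul_apply, ← hc.eq, Module.End.mul_apply] at h2
  rw [heightLT_one_le_ker hp hodd h1] at h2
  have h3 := (coeff_Delta_pow_self 1).1
  rw [pow_one, ← h2, map_zero] at h3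
  exact zero_ne_one h3

theorem prod_hecke_mem_heightLT {H : ℕ} {f : (ZMod 2)⟦X⟧} (l : List ℕ)
    (hl : ∀ q ∈ l, q.Prime ∧ Odd q) (hf : f ∈ heightLT (H + l.length)) :
    (l.map hecke).prod f ∈ heightLT H := by
  induction l generalizing H with
  | nil => exact hf
  | cons q l ih =>
    rw [List.map_cons, List.prod_cons, Module.End.mul_apply]
    have hq := hl q List.mem_cons_self
    refine hecke_mem_heightLT hq.1 hq.2 (ih (fun r hr => hl r (List.mem_cons_of_mem q hr)) ?_)
    rwa [List.length_cons, add_comm l.length, ← add_assoc] at hf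

theorem Leads.h_add_one_mem_nilpotencySet {f : (ZMod 2)⟦X⟧} {m : ℕ} (hf : Leads f m) :
    h m + 1 ∈ nilpotencySet f := by
  intro l hlen hl
  have := prod_hecke_mem_heightLT (H := 0) l hl
    (hf.mem_heightLT (by omega : h m < 0 + l.length))
  rwa [heightLT_zero, Submodule.mem_bot] at this

/-- The product of `n₃ m` factors `T₃` and `n₅ m` factors `T₅` does not annihilate `f`. -/
theorem Leads.lt_of_mem_nilpotencySet {f : (ZMod 2)⟦X⟧} {m : ℕ} (hf : Leads f m) {g : ℕ}
    (hg : g ∈ nilpotencySet f) : h m < g := by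
  by_contra hlt
  set l := List.replicate (n₃ m) 3 ++ List.replicate (n₅ m) 5 with hl
  have hlen : l.length = h m := by simp [hl, h]
  have hprime : ∀ q ∈ l, q.Prime ∧ Odd q := by
    intro q hq
    rw [hl, List.mem_append] at hq
    rcases hq with hq | hq <;> rw [List.eq_of_mem_replicate hq]
    · exact ⟨Nat.prime_three, by decide⟩
    · exact ⟨Nat.prime_five, by decide⟩
  have h1 : (l.map hecke).prod f = Delta := by
    rw [← hf.apply_eq_Delta, hl]
    simp
  have h2 := hg (l.drop (h m - g)) (by rw [List.length_drop]; omega)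
    fun q hq => hprime q (List.mem_of_mem_drop hq)
  rw [← List.take_append_drop (h m - g) l, List.map_append, List.prod_append,
    Module.End.mul_apply, h2, map_zero] at h1
  have h3 := (coeff_Delta_pow_self 1).1
  rw [pow_one, ← h1, map_zero] at h3
  exact zero_ne_one h3

theorem Leads.nilpotencyOrder_eq {f : (ZMod 2)⟦X⟧} {m : ℕ} (hf : Leads f m) :
    nilpotencyOrder f = hForm f + 1 := by
  have h1 : sInf (nilpotencySet f) = h m + 1 :=
    le_antisymm (Nat.sInf_le hf.h_add_one_mem_nilpotencySet)
      (le_csInf ⟨_, hf.h_add_one_mem_nilpotencySet⟩ fun _ hg => hf.lt_of_mem_nilpotencySet hg)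
  rw [nilpotencyOrder, if_neg hf.ne_zero, h1, hf.hForm_eq]
  rfl

theorem hForm_add_one_le {H : ℕ} {f : (ZMod 2)⟦X⟧} (hf : f ∈ heightLT H) :
    hForm f + 1 ≤ H := by
  rcases eq_or_ne f 0 with rfl | h0
  · simp [hForm, exponents_zero]
  obtain ⟨m, hm⟩ := exists_leads (powSpan_le_oddForms (fun _ he => he.1) hf) h0
  have := (exponents_subset hf m hm.isDominantExponent.1).2
  rw [hm.hForm_eq]
  exact_mod_cast this

end

end HeckeModTwo

theorem mainTheorem1 (f : PowerSeries (ZMod 2)) (hf : f ∈ HeckeModTwo.oddForms) (hf0 : f ≠ 0) :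
    ∃ m₁ : ℕ, HeckeModTwo.IsDominantExponent f m₁ ∧
      -- (i)
      (∀ p : ℕ, p = 3 ∨ p = 5 →
        HeckeModTwo.hecke p f ∈ HeckeModTwo.oddForms ∧
        HeckeModTwo.hForm (HeckeModTwo.hecke p f) + 1 ≤ HeckeModTwo.hForm f) ∧
      -- (ii)
      (1 ≤ HeckeModTwo.n₃ m₁ →
        HeckeModTwo.hecke 3 f ≠ 0 ∧
        ∃ m : ℕ, HeckeModTwo.IsDominantExponent (HeckeModTwo.hecke 3 f) m ∧
          HeckeModTwo.code m = (HeckeModTwo.n₃ m₁ - 1, HeckeModTwo.n₅ m₁)) ∧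
      -- (iii)
      (1 ≤ HeckeModTwo.n₅ m₁ →
        HeckeModTwo.hecke 5 f ≠ 0 ∧
        ∃ m : ℕ, HeckeModTwo.IsDominantExponent (HeckeModTwo.hecke 5 f) m ∧
          HeckeModTwo.code m = (HeckeModTwo.n₃ m₁, HeckeModTwo.n₅ m₁ - 1)) ∧
      -- (iv)
      (HeckeModTwo.hecke 3 ^ HeckeModTwo.n₃ m₁ * HeckeModTwo.hecke 5 ^ HeckeModTwo.n₅ m₁) f =
        HeckeModTwo.Delta ∧
      -- (v)
      (HeckeModTwo.nilpotencySet f).Nonempty ∧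
      HeckeModTwo.nilpotencyOrder f = HeckeModTwo.hForm f + 1 := by
  obtain ⟨m₁, hm₁⟩ := HeckeModTwo.exists_leads hf hf0
  refine ⟨m₁, hm₁.isDominantExponent, fun p hp => ?_, fun h3 => ?_, fun h5 => ?_,
    hm₁.apply_eq_Delta, ⟨_, hm₁.h_add_one_mem_nilpotencySet⟩, hm₁.nilpotencyOrder_eq⟩
  · have hp' : p.Prime ∧ Odd p := by
      rcases hp with rfl | rfl
      · exact ⟨Nat.prime_three, by decide⟩
      · exact ⟨Nat.prime_five, by decide⟩
    refine ⟨HeckeModTwo.hecke_mem_oddForms hp'.1 hp'.2 hf, ?_⟩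
    rw [hm₁.hForm_eq]
    exact HeckeModTwo.hForm_add_one_le
      (HeckeModTwo.hecke_mem_heightLT hp'.1 hp'.2 (hm₁.mem_heightLT (Nat.lt_succ_self _)))
  · obtain ⟨m, hm, hm3, hm5⟩ := hm₁.exists_apply
      (fun k hk => HeckeModTwo.hecke_three_lowersCode hk) (by omega)
    refine ⟨hm.ne_zero, m, hm.isDominantExponent, Prod.ext ?_ ?_⟩ <;>
      simp only [HeckeModTwo.code] <;> omega
  · obtain ⟨m, hm, hm3, hm5⟩ := hm₁.exists_apply
      (fun k hk => HeckeModTwo.hecke_five_lowersCode hk) (by omega)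
    refine ⟨hm.ne_zero, m, hm.isDominantExponent, Prod.ext ?_ ?_⟩ <;>
      simp only [HeckeModTwo.code] <;> omega
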